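/- **Proposition.** Let $\beta=(\beta_s)_{s\ge 0}$ and $\widetilde\beta=(\widetilde\beta_t)_{t\ge 0}$ be two independent standard Brownian motions in $\mathbb R^4$, both started at the origin, and let $$X=\int_0^1\int_0^1 \frac{1}{\|\beta_s-\widetilde\beta_t\|^{2}}\,ds\,dt\in[0,\infty],$$ where $\|\cdot\|$ is the Euclidean norm. There exist absolute constants $c,C,\theta>0$ such that the following hold. 1. For every real $p\ge 1$, $$c^p\,p^p\ \le\ \mathbb E\left[X^p\right]\ \le\ C^p\,p^{2p}.$$ 2. $X$ satisfies Carleman's condition: $\displaystyle\sum_{p\ge 1,\,p\in\mathbb N}\left(\mathbb E[X^p]\right)^{-\frac1{2p}}=\infty$. 3. $X$ has an infinite exponential moment: $\mathbb E\left[e^{\theta X}\right]=\infty$. -/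

import Mathlib

open MeasureTheory ProbabilityTheory
open scoped NNReal ENNReal

namespace BrownianCross

/-- A standard `d`-dimensional Brownian motion (started at the origin): its coordinates are
standard real Brownian motions and, as processes, they are independent. -/
structure IsStdBrownian {Ω : Type*} [MeasurableSpace Ω] {d : ℕ}
    (B : ℝ≥0 → Ω → EuclideanSpace ℝ (Fin d)) (P : Measure Ω) : Prop where
  isBrownianReal_coord : ∀ i : Fin d, IsBrownianReal (fun t ω => B t ω i) P
  iIndepFun_coord : iIndepFun (fun (i : Fin d) (ω : Ω) (t : ℝ≥0) => B t ω i) P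

/-- `∫₀¹ ∫₀¹ ‖β_s - β'_t‖⁻² ds dt`, as an integral of a `[0, ∞]`-valued function
(the integrand is `∞` where `β_s = β'_t`). -/
noncomputable def crossIntegral {Ω : Type*} {d : ℕ}
    (β β' : ℝ≥0 → Ω → EuclideanSpace ℝ (Fin d)) (ω : Ω) : ℝ≥0∞ :=
  ∫⁻ s in Set.Icc (0 : ℝ) 1, ∫⁻ t in Set.Icc (0 : ℝ) 1,
    1 / ‖β s.toNNReal ω - β' t.toNNReal ω‖ₑ ^ 2

/-- `E[X ^ p]` for a random variable with values in `[0, ∞]`. -/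
noncomputable def posMoment {Ω : Type*} [MeasurableSpace Ω]
    (X : Ω → ℝ≥0∞) (P : Measure Ω) (p : ℝ) : ℝ≥0∞ :=
  ∫⁻ ω, X ω ^ p ∂P

/-- Carleman's condition for a nonnegative random variable:
`∑_{p ≥ 1} E[X ^ p] ^ (-1 / (2 p)) = ∞`, the sum being over the integers `p ≥ 1`. -/
def CarlemanCondition {Ω : Type*} [MeasurableSpace Ω]
    (X : Ω → ℝ≥0∞) (P : Measure Ω) : Prop :=
  ∑' p : ℕ+, posMoment X P ((p : ℕ) : ℝ) ^ (-1 / (2 * ((p : ℕ) : ℝ))) = ∞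

/-- `E[exp (θ X)]` for a random variable with values in `[0, ∞]`. -/
noncomputable def expMoment {Ω : Type*} [MeasurableSpace Ω]
    (X : Ω → ℝ≥0∞) (P : Measure Ω) (θ : ℝ) : ℝ≥0∞ :=
  ∫⁻ ω, EReal.exp ((θ : EReal) * (X ω : EReal)) ∂P

end BrownianCross

/-! Upper bound. For integer `n`, `E[X^n]` is the integral over times `s`, `t` in the cube of `E ∏
‖β (s i) - β' (t i)‖⁻²`. By independence one motion may be frozen, leaving `E ∏ ‖β (s i) - y i‖⁻²`,
to be bounded uniformly in `y`. Writing `1/q = ∫ exp (-u q) du` over `u > 0` makes this a product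
over the coordinates of Gaussian expectations. Conditioning on fewer and fewer values bounds each by
`∏ (1 + 2 u i v i)^(-1/2)`, where `v i` is a conditional variance (`exists_conditional_variances`).
Four coordinates give the exponent `-2`, and integrating over `u` leaves `∏ 1/(2 v i)`, which is at
most `gapProduct s ^ 2`. This square has nonintegrable singularities `|s i - s j|⁻¹`. But freezing
the other motion gives `gapProduct t ^ 2` as well, and the smaller of two squares is at most the
product `gapProduct s * gapProduct t`, whose singularities have exponent `-1/2`. Each factor
integrates to at most `A^n n!`, whence the growth `p^(2p)`.

Lower bound. `X` is of order `n` when both paths have `∫ ‖β‖²` of order `1/n`, an event costing only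
`exp (-O(n))`. In analytic form, with `Q`, `Q'` the two integrals, `X ≥ e⁻² n exp (-n Q - n Q')`
(`ofReal_exp_mul_le_crossIntegral`). Also `E exp (-b² ∫ B²) ≥ e^(-b)` for real Brownian motion,
proved on a grid by a Riccati-type recursion (`pow_le_lintegral_exp_neg_grid`). Taking `n`-th powers
with `b = n` gives `E[X^n] ≥ (e⁻¹⁰ n)^n`.

Monotonicity of `L^p` norms passes to real `p`. The upper bound makes Carleman's series dominate a
harmonic series; the lower bound makes the exponential series diverge for large `θ`. -/

namespace BrownianCross

/-! ### Tonelli for products, and products of independent factors -/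

/-- Tonelli's theorem for `Fin (n + 1) → α`, splitting off the first coordinate. -/
theorem lintegral_pi_fin_succ {α : Type*} [MeasurableSpace α] (μ : Measure α) [SigmaFinite μ]
    {n : ℕ} {f : (Fin (n + 1) → α) → ℝ≥0∞} (hf : Measurable f) :
    ∫⁻ x, f x ∂(Measure.pi fun _ => μ) =
      ∫⁻ y, ∫⁻ a, f (Fin.cons a y) ∂μ ∂(Measure.pi fun _ : Fin n => μ) := by
  have h := (measurePreserving_piFinSuccAbove (fun _ : Fin (n + 1) => μ) 0).symm
  have hm : Measurable fun p : α × (Fin n → α) => f (Fin.cons p.1 p.2) := by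
    have := hf.comp h.measurable
    simpa [Function.comp_def, Fin.insertNthEquiv] using this
  have h2 := h.lintegral_comp hf
  rw [← h2]
  simp only [MeasurableEquiv.piFinSuccAbove_symm_apply, Fin.insertNthEquiv, Equiv.coe_fn_mk,
    Fin.insertNth_zero]
  exact lintegral_prod_symm' (μ := μ) (ν := Measure.pi fun _ : Fin n => μ) _ hm

theorem lintegral_pi_fin_prod {α : Type*} [MeasurableSpace α] (μ : Measure α) [SigmaFinite μ]
    {n : ℕ} {f : Fin n → α → ℝ≥0∞} (hf : ∀ i, Measurable (f i)) :
    ∫⁻ x, ∏ i, f i (x i) ∂(Measure.pi fun _ => μ) = ∏ i, ∫⁻ a, f i a ∂μ := by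
  induction n with
  | zero => simp
  | succ n ih =>
    rw [lintegral_pi_fin_succ μ (by fun_prop)]
    simp only [Fin.prod_univ_succ, Fin.cons_zero, Fin.cons_succ]
    have h : ∀ y : Fin n → α, ∫⁻ a, f 0 a * ∏ i, f i.succ (y i) ∂μ =
        (∫⁻ a, f 0 a ∂μ) * ∏ i, f i.succ (y i) := fun y => lintegral_mul_const _ (hf 0)
    simp only [h]
    rw [lintegral_const_mul _ (by fun_prop), ih fun i => hf i.succ]

theorem lintegral_prod_of_iIndepFun {Ω ι : Type*} [MeasurableSpace Ω] {P : Measure Ω}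
    [Fintype ι] {X : ι → Ω → ℝ≥0∞} (hX : iIndepFun X P) (hm : ∀ i, AEMeasurable (X i) P) :
    ∫⁻ ω, ∏ i, X i ω ∂P = ∏ i, ∫⁻ ω, X i ω ∂P := by
  have h1 : ∀ i, ∫⁻ ω, X i ω ∂P = ∫⁻ ω, (hm i).mk _ ω ∂P :=
    fun i => lintegral_congr_ae (hm i).ae_eq_mk
  have h2 : ∀ᵐ ω ∂P, ∏ i, X i ω = ∏ i, (hm i).mk _ ω := by
    filter_upwards [ae_all_iff.2 fun i => (hm i).ae_eq_mk] with ω hω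
    exact Finset.prod_congr rfl fun i _ => hω i
  rw [lintegral_congr_ae h2, lintegral_prod_eq_prod_lintegral_of_indepFun Finset.univ
    (fun i => (hm i).mk _) (hX.congr fun i => (hm i).ae_eq_mk) fun i => (hm i).measurable_mk]
  simp only [h1]

/-- Tonelli for a function of two independent random variables. -/
theorem lintegral_of_indepFun {Ω S T : Type*} [MeasurableSpace Ω] [MeasurableSpace S]
    [MeasurableSpace T] {P : Measure Ω} [IsProbabilityMeasure P] {V : Ω → S} {W : Ω → T}
    (hV : AEMeasurable V P) (hW : AEMeasurable W P) (h : IndepFun V W P)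
    {f : S → T → ℝ≥0∞} (hf : Measurable (Function.uncurry f)) :
    ∫⁻ ω, f (V ω) (W ω) ∂P = ∫⁻ ω, ∫⁻ z, f (V ω) z ∂(P.map W) ∂P := by
  have h1 := (indepFun_iff_map_prod_eq_prod_map_map hV hW).1 h
  have : IsProbabilityMeasure (P.map W) := Measure.isProbabilityMeasure_map hW
  calc ∫⁻ ω, f (V ω) (W ω) ∂P = ∫⁻ p, Function.uncurry f p ∂(P.map fun ω => (V ω, W ω)) :=
        (lintegral_map' hf.aemeasurable (hV.prodMk hW)).symm
    _ = ∫⁻ x, ∫⁻ z, f x z ∂(P.map W) ∂(P.map V) := by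
        rw [h1, lintegral_prod _ hf.aemeasurable]; rfl
    _ = _ := lintegral_map' (f := fun x => ∫⁻ z, f x z ∂(P.map W))
        (Measurable.lintegral_prod_right hf).aemeasurable hV

/-! ### Gaussian smoothing of `exp (-b x²)` -/

/-- Complete the square in `z`. The map `b ↦ b / (1 + 2 b v)` drives the grid recursion of the lower
bound, while the prefactor carries the upper bound. The degenerate variance `v = 0` has no density
and is treated apart. -/
theorem lintegral_exp_neg_mul_sq_gaussianReal (v : ℝ≥0) {b : ℝ} (hb : 0 ≤ b) (x : ℝ) :
    ∫⁻ z, ENNReal.ofReal (Real.exp (-(b * (x + z) ^ 2))) ∂gaussianReal 0 v =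
      ENNReal.ofReal ((√(1 + 2 * b * v))⁻¹) *
        ENNReal.ofReal (Real.exp (-(b / (1 + 2 * b * v) * x ^ 2))) := by
  rw [← ENNReal.ofReal_mul (by positivity)]
  by_cases hv : v = 0
  · subst hv
    rw [gaussianReal_zero_var, lintegral_dirac]
    simp
  have hv' : (0 : ℝ) < v := by positivity
  rw [← ofReal_integral_eq_lintegral_ofReal]
  · congr 1
    rw [integral_gaussianReal_eq_integral_smul hv]
    have key : ∀ z : ℝ, gaussianPDFReal 0 v z • Real.exp (-(b * (x + z) ^ 2)) =
        ((√(2 * Real.pi * v))⁻¹ * Real.exp (-(b / (1 + 2 * b * v) * x ^ 2))) *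
          Real.exp (-(1 / (2 * v) + b) * (z + 2 * v * b * x / (1 + 2 * b * v)) ^ 2) := by
      intro z
      have h1 : (1 + 2 * b * (v : ℝ)) ≠ 0 := by positivity
      rw [gaussianPDFReal, smul_eq_mul, mul_assoc, ← Real.exp_add, mul_assoc (√_)⁻¹, ← Real.exp_add]
      congr 2
      field_simp
      ring
    simp only [key]
    rw [integral_const_mul, integral_add_right_eq_self
      (fun z : ℝ => Real.exp (-(1 / (2 * (v : ℝ)) + b) * z ^ 2)), integral_gaussian]
    rw [mul_right_comm]
    congr 1
    rw [← Real.sqrt_inv, ← Real.sqrt_inv, ← Real.sqrt_mul (by positivity)]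
    congr 1
    have h1 : (1 + 2 * b * (v : ℝ)) ≠ 0 := by positivity
    have h2 : (1 / (2 * (v : ℝ)) + b) = (1 + 2 * b * v) / (2 * v) := by field_simp
    rw [h2]
    field_simp
  · refine Integrable.of_bound (by fun_prop) 1 (Filter.Eventually.of_forall fun z => ?_)
    rw [Real.norm_of_nonneg (Real.exp_pos _).le, Real.exp_le_one_iff]
    have : 0 ≤ b * (x + z) ^ 2 := by positivity
    linarith
  · exact Filter.Eventually.of_forall fun z => (Real.exp_pos _).le

/-- Integrating out an independent centred Gaussian `W` in `g V * exp (-b (h V + W)²)`. -/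
theorem lintegral_mul_exp_neg_mul_sq_of_indepFun {Ω S : Type*} [MeasurableSpace Ω]
    [MeasurableSpace S] {P : Measure Ω} [IsProbabilityMeasure P] {V : Ω → S} {W : Ω → ℝ}
    (hV : AEMeasurable V P) {v : ℝ≥0} (hW : HasLaw W (gaussianReal 0 v) P) (hVW : IndepFun V W P)
    {g : S → ℝ≥0∞} (hg : Measurable g) {h : S → ℝ} (hh : Measurable h) {b : ℝ} (hb : 0 ≤ b) :
    ∫⁻ ω, g (V ω) * ENNReal.ofReal (Real.exp (-(b * (h (V ω) + W ω) ^ 2))) ∂P =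
      ENNReal.ofReal ((√(1 + 2 * b * v))⁻¹) *
        ∫⁻ ω, g (V ω) * ENNReal.ofReal (Real.exp (-(b / (1 + 2 * b * v) * h (V ω) ^ 2))) ∂P := by
  have hf : Measurable (Function.uncurry fun (x : S) (z : ℝ) =>
      g x * ENNReal.ofReal (Real.exp (-(b * (h x + z) ^ 2)))) := by
    simp only [Function.uncurry_def]; fun_prop
  rw [lintegral_of_indepFun hV hW.aemeasurable hVW hf, hW.map_eq, ← lintegral_const_mul'']
  · refine lintegral_congr fun ω => ?_
    rw [lintegral_const_mul _ (by fun_prop), lintegral_exp_neg_mul_sq_gaussianReal v hb]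
    ring
  · exact ((show Measurable fun x => g x *
      ENNReal.ofReal (Real.exp (-(b / (1 + 2 * b * v) * h x ^ 2))) by fun_prop).comp_aemeasurable
        hV)

/-! ### Linear prediction of Brownian motion from finitely many values -/

/-- Interpolation between the neighbours of `s` in a finite set of times `τ` containing `0` gives
the best linear predictor of `B s`; its error variance is at least half the distance from `s` to
one of the times. -/
theorem exists_linear_predictor {ι : Type*} [Fintype ι] (τ : ι → ℝ≥0) (i₀ : ι) (h₀ : τ i₀ = 0)
    (s : ℝ≥0) :
    ∃ (i j : ι) (α γ : ℝ) (v : ℝ≥0),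
      (∀ r, ((min s (τ r) : ℝ≥0) : ℝ) =
        α * (min (τ i) (τ r) : ℝ≥0) + γ * (min (τ j) (τ r) : ℝ≥0)) ∧
      (v : ℝ) = s - α * (min (τ i) s : ℝ≥0) - γ * (min (τ j) s : ℝ≥0) ∧
      ∃ k, |(s : ℝ) - τ k| / 2 ≤ v := by
  classical
  obtain ⟨i, hi, hmax⟩ := Finset.exists_max_image (Finset.univ.filter fun i => τ i ≤ s) τ
    ⟨i₀, by simp [h₀]⟩
  simp only [Finset.mem_filter, Finset.mem_univ, true_and] at hi hmax
  have hi' : (τ i : ℝ) ≤ s := by exact_mod_cast hi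
  by_cases hne : (Finset.univ.filter fun i => s < τ i).Nonempty
  · obtain ⟨j, hj, hmin⟩ := Finset.exists_min_image _ τ hne
    simp only [Finset.mem_filter, Finset.mem_univ, true_and] at hj hmin
    have hj' : (s : ℝ) < τ j := by exact_mod_cast hj
    have hd : (0 : ℝ) < τ j - τ i := by linarith
    have hv : (0 : ℝ) ≤ ((τ j - s) * (s - τ i)) / (τ j - τ i) :=
      div_nonneg (mul_nonneg (by linarith) (by linarith)) hd.le
    obtain ⟨v, hv'⟩ : ∃ v : ℝ≥0, (v : ℝ) = ((τ j - s) * (s - τ i)) / (τ j - τ i) :=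
      ⟨Real.toNNReal _, Real.coe_toNNReal _ hv⟩
    -- Brownian bridge between the two neighbours of `s`: interpolation weights and bridge variance.
    refine ⟨i, j, (τ j - s) / (τ j - τ i), (s - τ i) / (τ j - τ i), v, fun r => ?_, ?_, ?_⟩
    · rcases le_or_gt (τ r) s with hr | hr
      · have h1 := hmax r hr
        rw [min_eq_right hr, min_eq_right h1, min_eq_right (hr.trans hj.le)]
        field_simp; ring
      · have h1 := hmin r hr
        rw [min_eq_left hr.le, min_eq_left (hi.trans hr.le), min_eq_left h1]
        field_simp; ring
    · rw [min_eq_left hi, min_eq_right hj.le, hv']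
      field_simp; ring
    · rw [hv']
      -- The farther neighbour is at distance at least `(τ j - τ i) / 2`, so the variance is at
      -- least half the distance to the nearer one.
      rcases le_total ((s : ℝ) - τ i) (τ j - s) with h | h
      · refine ⟨i, ?_⟩
        rw [abs_of_nonneg (by linarith), le_div_iff₀ hd]
        nlinarith
      · refine ⟨j, ?_⟩
        rw [abs_of_neg (by linarith), le_div_iff₀ hd]
        nlinarith
  · have hle : ∀ r, τ r ≤ s := fun r => by
      by_contra hr
      exact hne ⟨r, by simpa using hr⟩
    -- No time lies beyond `s`: the last value is the predictor, and the second index is a dummy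
    -- with coefficient `0`.
    refine ⟨i, i, 1, 0, s - τ i, fun r => ?_, ?_, i, ?_⟩
    · rw [min_eq_right (hle r), min_eq_right (hmax r (hle r))]; ring
    · rw [min_eq_left hi, NNReal.coe_sub hi]; ring
    · rw [NNReal.coe_sub hi, abs_of_nonneg (by linarith)]; linarith

/-- The error of the linear predictor is a centred Gaussian, independent of the data. -/
theorem predictor_error_hasLaw_indepFun {Ω ι : Type*} [MeasurableSpace Ω] {P : Measure Ω}
    [IsProbabilityMeasure P] {B : ℝ≥0 → Ω → ℝ} (hB : IsPreBrownianReal B P) (τ : ι → ℝ≥0)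
    (s : ℝ≥0) (i j : ι) (α γ : ℝ) (v : ℝ≥0)
    (hcov : ∀ r, ((min s (τ r) : ℝ≥0) : ℝ) =
        α * (min (τ i) (τ r) : ℝ≥0) + γ * (min (τ j) (τ r) : ℝ≥0))
    (hvar : (v : ℝ) = s - α * (min (τ i) s : ℝ≥0) - γ * (min (τ j) s : ℝ≥0)) :
    HasLaw (fun ω => B s ω - (α * B (τ i) ω + γ * B (τ j) ω)) (gaussianReal 0 v) P ∧
      IndepFun (fun ω r => B (τ r) ω) (fun ω => B s ω - (α * B (τ i) ω + γ * B (τ j) ω)) P := by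
  classical
  set Z : Ω → ℝ := fun ω => B s ω - (α * B (τ i) ω + γ * B (τ j) ω) with hZ
  have hL2 : ∀ t, MemLp (B t) 2 P := fun t => (hB.isGaussianProcess.hasGaussianLaw_eval t).memLp_two
  have hint : ∀ t, Integrable (B t) P := fun t => hB.integrable_eval t
  have hcZ : ∀ t, cov[Z, B t; P] = (min s t : ℝ≥0) -
      (α * (min (τ i) t : ℝ≥0) + γ * (min (τ j) t : ℝ≥0)) := by
    intro t
    have h1 : Z = B s - (α • B (τ i) + γ • B (τ j)) := by ext; simp [hZ]
    rw [h1, covariance_sub_left (hL2 _) (((hL2 _).const_smul α).add ((hL2 _).const_smul γ)) (hL2 _),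
      covariance_add_left ((hL2 _).const_smul α) ((hL2 _).const_smul γ) (hL2 _),
      covariance_smul_left, covariance_smul_left, hB.covariance_eval, hB.covariance_eval,
      hB.covariance_eval]
  have hZr : ∀ r, cov[Z, B (τ r); P] = 0 := fun r => by rw [hcZ, hcov r]; ring
  -- The data and the error are jointly Gaussian, being linear images of the process, so their
  -- vanishing covariances give independence.
  have hG : IsGaussianProcess (Sum.elim (fun r : ι => B (τ r)) fun _ : Unit => Z) P := by
    apply hB.isGaussianProcess.of_isGaussianProcess
    rintro (r | u)
    · exact ⟨{τ r},
        { toFun x := x ⟨τ r, by simp⟩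
          map_add' x y := by simp
          map_smul' c x := by simp }, by simp⟩
    · exact ⟨{s, τ i, τ j},
        { toFun x := x ⟨s, by simp⟩ - (α * x ⟨τ i, by simp⟩ + γ * x ⟨τ j, by simp⟩)
          map_add' x y := by simp; ring
          map_smul' c x := by simp; ring }, by simp [hZ]⟩
  have hZG : HasGaussianLaw Z P := hG.hasGaussianLaw_eval (Sum.inr ())
  have hZL2 : MemLp Z 2 P := hZG.memLp_two
  refine ⟨⟨hZG.aemeasurable, ?_⟩, ?_⟩
  · have hmean : P[Z] = 0 := by
      have h1 : Integrable (fun ω => α * B (τ i) ω) P := (hint _).const_mul α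
      have h2 : Integrable (fun ω => γ * B (τ j) ω) P := (hint _).const_mul γ
      have h3 : Integrable (fun ω => α * B (τ i) ω + γ * B (τ j) ω) P := h1.add h2
      change ∫ ω, (B s ω - (α * B (τ i) ω + γ * B (τ j) ω)) ∂P = 0
      rw [integral_sub (hint s) h3, integral_add h1 h2, integral_const_mul,
        integral_const_mul, hB.integral_eval, hB.integral_eval, hB.integral_eval]
      ring
    have hvarZ : Var[Z; P] = v := by
      rw [← covariance_self hZG.aemeasurable]
      have h1 : cov[Z, Z; P] = cov[Z, B s - (α • B (τ i) + γ • B (τ j)); P] := by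
        congr 1
      rw [h1, covariance_sub_right hZL2 (hL2 _)
        (((hL2 _).const_smul α).add ((hL2 _).const_smul γ)),
        covariance_add_right hZL2 ((hL2 _).const_smul α) ((hL2 _).const_smul γ),
        covariance_smul_right, covariance_smul_right, hZr, hZr, hcZ, min_self, hvar]
      ring
    have := hZG.map_eq_gaussianReal
    rw [this, hmean, hvarZ, Real.toNNReal_coe]
  · have h := IsGaussianProcess.indepFun_of_covariance_eq_zero hG (fun r => hB.aemeasurable _)
      (fun _ => hZG.aemeasurable) fun r _ => by rw [covariance_comm]; exact hZr r
    exact h.comp measurable_id (measurable_pi_apply ())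

/-! ### Joint inverse-square moments at fixed times -/

/-- The sum of `|x - r| ^ (-1/2)` over `r = 0` and the entries `r` of `s`. -/
noncomputable def gapWeight {n : ℕ} (x : ℝ) (s : Fin n → ℝ) : ℝ≥0∞ :=
  ∑ k, ENNReal.ofReal |x - (Fin.cons 0 s : Fin (n + 1) → ℝ) k| ^ (-(1 / 2) : ℝ)

/-- The product of the weights of each `s i` relative to `0` and the later entries. -/
noncomputable def gapProduct : (n : ℕ) → (Fin n → ℝ) → ℝ≥0∞
  | 0, _ => 1
  | n + 1, s => gapWeight (s 0) (Fin.tail s) * gapProduct n (Fin.tail s)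

/-- Summing over all times in `gapWeight` avoids tracking which one is the relevant neighbour: the
single term `k`, squared, already gives the bound. -/
theorem inv_two_mul_le_gapWeight_sq {n : ℕ} {x : ℝ} {s : Fin n → ℝ} {v : ℝ≥0} {k : Fin (n + 1)}
    (h : |x - (Fin.cons 0 s : Fin (n + 1) → ℝ) k| / 2 ≤ v) :
    (2 * (v : ℝ≥0∞))⁻¹ ≤ gapWeight x s ^ 2 := by
  set d := |x - (Fin.cons 0 s : Fin (n + 1) → ℝ) k| with hd
  have h1 : ENNReal.ofReal d ≤ 2 * (v : ℝ≥0∞) := by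
    rw [← ENNReal.ofReal_coe_nnreal, ← ENNReal.ofReal_ofNat, ← ENNReal.ofReal_mul (by norm_num)]
    exact ENNReal.ofReal_le_ofReal (by linarith)
  have h2 : (ENNReal.ofReal d)⁻¹ = (ENNReal.ofReal d ^ (-(1 / 2) : ℝ)) ^ 2 := by
    rw [← ENNReal.rpow_natCast, ← ENNReal.rpow_mul, ← ENNReal.rpow_neg_one]
    norm_num
  calc (2 * (v : ℝ≥0∞))⁻¹ ≤ (ENNReal.ofReal d)⁻¹ := ENNReal.inv_le_inv.2 h1
    _ = (ENNReal.ofReal d ^ (-(1 / 2) : ℝ)) ^ 2 := h2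
    _ ≤ gapWeight x s ^ 2 := by
        gcongr
        exact Finset.single_le_sum
          (f := fun k => ENNReal.ofReal |x - (Fin.cons 0 s : Fin (n + 1) → ℝ) k| ^ (-(1 / 2) : ℝ))
          (fun _ _ => zero_le) (Finset.mem_univ k)

/-- Conditioning successively on fewer values bounds a Gaussian functional of
`(B (s i))_i` by the product over the conditional variances. -/
theorem exists_conditional_variances {Ω : Type*} [MeasurableSpace Ω] (P : Measure Ω)
    [IsProbabilityMeasure P] (n : ℕ) (s : Fin n → ℝ≥0) :
    ∃ v : Fin n → ℝ≥0, ∏ i, (2 * (v i : ℝ≥0∞))⁻¹ ≤ gapProduct n (fun i => s i) ^ 2 ∧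
      ∀ B : ℝ≥0 → Ω → ℝ, IsPreBrownianReal B P → ∀ u y : Fin n → ℝ, (∀ i, 0 ≤ u i) →
        ∫⁻ ω, ∏ i, ENNReal.ofReal (Real.exp (-(u i * (B (s i) ω - y i) ^ 2))) ∂P ≤
          ∏ i, ENNReal.ofReal ((√(1 + 2 * u i * v i))⁻¹) := by
  induction n with
  | zero => exact ⟨fun i => 0, by simp [gapProduct], fun B _ u y _ => by simp⟩
  | succ n ih =>
    obtain ⟨v', hv', hB'⟩ := ih (Fin.tail s)
    -- Time `0` is added so that `s 0` always has a neighbour on its left.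
    set τ : Fin (n + 1) → ℝ≥0 := Fin.cons 0 (Fin.tail s) with hτ
    have hτc : ∀ k, ((τ k : ℝ≥0) : ℝ) =
        (Fin.cons 0 (fun i => (Fin.tail s i : ℝ)) : Fin (n + 1) → ℝ) k := by
      intro k
      refine Fin.cases ?_ (fun k => ?_) k <;> simp [hτ]
    obtain ⟨i, j, α, γ, v, hcov, hvar, k, hk⟩ := exists_linear_predictor τ 0 rfl (s 0)
    refine ⟨Fin.cons v v', ?_, fun B hB u y hu => ?_⟩
    · rw [Fin.prod_univ_succ]
      simp only [Fin.cons_zero, Fin.cons_succ, gapProduct]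
      rw [mul_pow]
      refine mul_le_mul' (inv_two_mul_le_gapWeight_sq (k := k) ?_) hv'
      rw [hτc] at hk
      exact hk
    · obtain ⟨hlaw, hind⟩ := predictor_error_hasLaw_indepFun hB τ (s 0) i j α γ v hcov hvar
      have hV : AEMeasurable (fun ω r => B (τ r) ω) P :=
        aemeasurable_pi_lambda _ fun r => hB.aemeasurable _
      have key := lintegral_mul_exp_neg_mul_sq_of_indepFun hV hlaw hind
        (g := fun x => ∏ i : Fin n,
          ENNReal.ofReal (Real.exp (-(u i.succ * (x i.succ - y i.succ) ^ 2))))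
        (by fun_prop) (h := fun x => α * x i + γ * x j - y 0) (by fun_prop) (hu 0)
      have hτs : ∀ i : Fin n, τ i.succ = s i.succ := fun i => rfl
      rw [Fin.prod_univ_succ]
      simp only [Fin.prod_univ_succ, Fin.cons_zero, Fin.cons_succ]
      calc _ = ∫⁻ ω, (∏ i : Fin n, ENNReal.ofReal
              (Real.exp (-(u i.succ * (B (τ i.succ) ω - y i.succ) ^ 2)))) *
            ENNReal.ofReal (Real.exp (-(u 0 * (α * B (τ i) ω + γ * B (τ j) ω - y 0 +
              (B (s 0) ω - (α * B (τ i) ω + γ * B (τ j) ω))) ^ 2))) ∂P := by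
            refine lintegral_congr fun ω => ?_
            rw [mul_comm]
            congr 6
            ring
        _ ≤ _ := by
            rw [key]
            gcongr
            -- After the prediction error is integrated out, the leftover Gaussian factor is at most
            -- `1` and is discarded.
            refine le_trans ?_ (hB' B hB (fun i => u i.succ) (fun i => y i.succ) fun i => hu _)
            refine lintegral_mono fun ω => ?_
            refine mul_le_of_le_one_right' ?_
            rw [ENNReal.ofReal_le_one, Real.exp_le_one_iff, neg_nonpos]
            have := hu 0
            positivity

/-- At `q = 0` both sides are `∞`, so collisions of the paths need no separate treatment. -/
theorem inv_ofReal_eq_lintegral {q : ℝ} (hq : 0 ≤ q) :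
    (ENNReal.ofReal q)⁻¹ = ∫⁻ u in Set.Ioi (0 : ℝ), ENNReal.ofReal (Real.exp (-(u * q))) := by
  rcases hq.eq_or_lt with rfl | hq
  · simp
  · have h1 : ∀ u : ℝ, Real.exp (-(u * q)) = Real.exp (-q * u) := fun u => by ring_nf
    simp only [h1]
    rw [← ofReal_integral_eq_lintegral_ofReal (integrableOn_exp_mul_Ioi (by linarith) 0)
      (Filter.Eventually.of_forall fun _ => (Real.exp_pos _).le),
      integral_exp_mul_Ioi (by linarith), ← ENNReal.ofReal_inv_of_pos hq]
    congr 1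
    simp

/-- This is where dimension four enters: the integrand is `(1 + 2 u v)⁻²`, with an explicit
antiderivative. For `v = 0` the right side is `∞`. -/
theorem lintegral_inv_sqrt_pow_four_le (v : ℝ≥0) :
    ∫⁻ u in Set.Ioi (0 : ℝ), ENNReal.ofReal ((√(1 + 2 * u * v))⁻¹) ^ 4 ≤ (2 * (v : ℝ≥0∞))⁻¹ := by
  by_cases hv : v = 0
  · simp [hv]
  have hv' : (0 : ℝ) < v := by positivity
  have h1 : ∀ u ∈ Set.Ioi (0 : ℝ), ENNReal.ofReal ((√(1 + 2 * u * v))⁻¹) ^ 4 =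
      ENNReal.ofReal (((1 + 2 * u * v) ^ 2)⁻¹) := by
    intro u hu
    have hu : (0 : ℝ) < u := hu
    rw [← ENNReal.ofReal_pow (by positivity), inv_pow,
      show (√(1 + 2 * u * (v : ℝ))) ^ 4 = ((√(1 + 2 * u * v)) ^ 2) ^ 2 by ring,
      Real.sq_sqrt (by positivity)]
  rw [setLIntegral_congr_fun measurableSet_Ioi h1]
  have hd : ∀ u ∈ Set.Ici (0 : ℝ), HasDerivAt (fun u : ℝ => -((2 * (v : ℝ))⁻¹ * (1 + 2 * u * v)⁻¹))
      (((1 + 2 * u * v) ^ 2)⁻¹) u := by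
    intro u hu
    have hu : (0 : ℝ) ≤ u := hu
    have hne : 1 + 2 * u * (v : ℝ) ≠ 0 := by positivity
    have h2 : HasDerivAt (fun u : ℝ => 1 + 2 * u * (v : ℝ)) (2 * v) u := by
      have := (((hasDerivAt_id u).const_mul 2).mul_const (v : ℝ)).const_add 1
      simpa using this
    have h3 := ((h2.inv hne).const_mul ((2 * (v : ℝ))⁻¹)).neg
    refine h3.congr_deriv ?_
    field_simp
  have ht : Filter.Tendsto (fun u : ℝ => -((2 * (v : ℝ))⁻¹ * (1 + 2 * u * v)⁻¹)) Filter.atTop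
      (nhds 0) := by
    have h2 : Filter.Tendsto (fun u : ℝ => 1 + 2 * u * (v : ℝ)) Filter.atTop Filter.atTop :=
      Filter.tendsto_atTop_add_const_left _ _
        ((Filter.tendsto_id.const_mul_atTop (by norm_num : (0 : ℝ) < 2)).atTop_mul_const hv')
    have h3 := (h2.inv_tendsto_atTop.const_mul ((2 * (v : ℝ))⁻¹)).neg
    simpa using h3
  have hpos : ∀ u ∈ Set.Ioi (0 : ℝ), 0 ≤ ((1 + 2 * u * (v : ℝ)) ^ 2)⁻¹ := fun u _ => by positivity
  rw [← ofReal_integral_eq_lintegral_ofReal (integrableOn_Ioi_deriv_of_nonneg' hd hpos ht)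
    ((ae_restrict_iff' measurableSet_Ioi).2 (Filter.Eventually.of_forall hpos)),
    integral_Ioi_of_hasDerivAt_of_nonneg' hd hpos ht]
  rw [← ENNReal.ofReal_coe_nnreal, ← ENNReal.ofReal_ofNat, ← ENNReal.ofReal_mul (by norm_num),
    ← ENNReal.ofReal_inv_of_pos (by positivity)]
  apply le_of_eq
  congr 1
  simp

theorem one_div_enorm_sq_eq {d : ℕ} (x : EuclideanSpace ℝ (Fin d)) :
    1 / ‖x‖ₑ ^ 2 = ∫⁻ u in Set.Ioi (0 : ℝ),
      ∏ k, ENNReal.ofReal (Real.exp (-(u * (x k) ^ 2))) := by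
  rw [one_div, ← ofReal_norm, ← ENNReal.ofReal_pow (norm_nonneg _),
    inv_ofReal_eq_lintegral (by positivity)]
  refine lintegral_congr fun u => ?_
  rw [← ENNReal.ofReal_prod_of_nonneg fun _ _ => (Real.exp_pos _).le, ← Real.exp_sum,
    EuclideanSpace.real_norm_sq_eq, Finset.mul_sum, Finset.sum_neg_distrib]

theorem IsStdBrownian.aemeasurable {Ω : Type*} [MeasurableSpace Ω] {P : Measure Ω} {d : ℕ}
    {β : ℝ≥0 → Ω → EuclideanSpace ℝ (Fin d)} (hβ : IsStdBrownian β P) (t : ℝ≥0) :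
    AEMeasurable (β t) P := by
  have h : AEMeasurable (fun ω k => β t ω k) P :=
    aemeasurable_pi_lambda _ fun k => (hβ.isBrownianReal_coord k).aemeasurable t
  exact (WithLp.measurable_toLp 2 (Fin d → ℝ)).comp_aemeasurable h

theorem lintegral_prod_prod_exp_eq {Ω : Type*} [MeasurableSpace Ω] {P : Measure Ω} {d : ℕ}
    {β : ℝ≥0 → Ω → EuclideanSpace ℝ (Fin d)} (hβ : IsStdBrownian β P)
    {n : ℕ} (s : Fin n → ℝ≥0) (y : Fin n → EuclideanSpace ℝ (Fin d)) (u : Fin n → ℝ) :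
    ∫⁻ ω, ∏ i, ∏ k, ENNReal.ofReal (Real.exp (-(u i * ((β (s i) ω - y i) k) ^ 2))) ∂P =
      ∏ k, ∫⁻ ω, ∏ i, ENNReal.ofReal (Real.exp (-(u i * (β (s i) ω k - y i k) ^ 2))) ∂P := by
  have hind : iIndepFun (fun (k : Fin d) ω =>
      ∏ i, ENNReal.ofReal (Real.exp (-(u i * (β (s i) ω k - y i k) ^ 2)))) P :=
    hβ.iIndepFun_coord.comp
      (fun k x => ∏ i, ENNReal.ofReal (Real.exp (-(u i * (x (s i) - y i k) ^ 2))))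
      fun k => by fun_prop
  have hm : ∀ k, AEMeasurable (fun ω =>
      ∏ i, ENNReal.ofReal (Real.exp (-(u i * (β (s i) ω k - y i k) ^ 2)))) P := fun k => by
    have h1 : ∀ i, AEMeasurable (fun ω => β (s i) ω k) P :=
      fun i => (hβ.isBrownianReal_coord k).aemeasurable _
    fun_prop
  rw [← lintegral_prod_of_iIndepFun hind hm]
  refine lintegral_congr fun ω => ?_
  rw [Finset.prod_comm]
  rfl

theorem lintegral_lintegral_swap_comp {Ω S T : Type*} [MeasurableSpace Ω] [MeasurableSpace S]
    [MeasurableSpace T] {P : Measure Ω} [SFinite P] {ρ : Measure T} [SFinite ρ] {V : Ω → S}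
    (hV : AEMeasurable V P) {F : S × T → ℝ≥0∞} (hF : Measurable F) :
    ∫⁻ ω, ∫⁻ u, F (V ω, u) ∂ρ ∂P = ∫⁻ u, ∫⁻ ω, F (V ω, u) ∂P ∂ρ :=
  lintegral_lintegral_swap (f := fun ω u => F (V ω, u)) (hF.comp_aemeasurable
    ((hV.comp_quasiMeasurePreserving Measure.quasiMeasurePreserving_fst).prodMk
      measurable_snd.aemeasurable))

theorem lintegral_prod_inv_enorm_sub_sq_eq {Ω : Type*} [MeasurableSpace Ω] {P : Measure Ω}
    [SFinite P] {d n : ℕ} {V : Fin n → Ω → EuclideanSpace ℝ (Fin d)}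
    (hV : ∀ i, AEMeasurable (V i) P) (y : Fin n → EuclideanSpace ℝ (Fin d)) :
    ∫⁻ ω, ∏ i, 1 / ‖V i ω - y i‖ₑ ^ 2 ∂P =
      ∫⁻ u, ∫⁻ ω, ∏ i, ∏ k, ENNReal.ofReal (Real.exp (-(u i * ((V i ω - y i) k) ^ 2))) ∂P
        ∂(Measure.pi fun _ : Fin n => volume.restrict (Set.Ioi (0 : ℝ))) := by
  have hF : Measurable fun p : (Fin n → EuclideanSpace ℝ (Fin d)) × (Fin n → ℝ) =>
      ∏ i, ∏ k, ENNReal.ofReal (Real.exp (-(p.2 i * ((p.1 i - y i) k) ^ 2))) := by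
    fun_prop
  rw [← lintegral_lintegral_swap_comp (aemeasurable_pi_lambda _ hV) hF]
  refine lintegral_congr fun ω => ?_
  rw [lintegral_pi_fin_prod _ (f := fun i a =>
    ∏ k, ENNReal.ofReal (Real.exp (-(a * ((V i ω - y i) k) ^ 2)))) (by fun_prop)]
  exact Finset.prod_congr rfl fun i _ => one_div_enorm_sq_eq _

/-- The variances from `exists_conditional_variances` depend only on the times, so the same ones
serve all four coordinates, all `u` and all shifts `y`. Uniformity in `y` is what permits freezing
the other motion. -/
theorem lintegral_prod_inv_enorm_sub_sq_le {Ω : Type*} [MeasurableSpace Ω] {P : Measure Ω}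
    [IsProbabilityMeasure P] {β : ℝ≥0 → Ω → EuclideanSpace ℝ (Fin 4)} (hβ : IsStdBrownian β P)
    {n : ℕ} (s : Fin n → ℝ≥0) (y : Fin n → EuclideanSpace ℝ (Fin 4)) :
    ∫⁻ ω, ∏ i, 1 / ‖β (s i) ω - y i‖ₑ ^ 2 ∂P ≤ gapProduct n (fun i => s i) ^ 2 := by
  obtain ⟨v, hv, hB⟩ := exists_conditional_variances P n s
  refine le_trans ?_ hv
  rw [lintegral_prod_inv_enorm_sub_sq_eq (fun i => hβ.aemeasurable (s i)) y]
  have hpos : ∀ᵐ u ∂(Measure.pi fun _ : Fin n => volume.restrict (Set.Ioi (0 : ℝ))),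
      ∀ i, 0 ≤ u i := by
    refine ae_all_iff.2 fun i => ?_
    have h1 : ∀ᵐ a ∂volume.restrict (Set.Ioi (0 : ℝ)), 0 ≤ a := by
      filter_upwards [ae_restrict_mem measurableSet_Ioi] with a ha using le_of_lt ha
    exact Measure.tendsto_eval_ae_ae.eventually h1
  calc _ ≤ ∫⁻ u, ∏ i, ENNReal.ofReal ((√(1 + 2 * u i * v i))⁻¹) ^ 4
          ∂(Measure.pi fun _ : Fin n => volume.restrict (Set.Ioi (0 : ℝ))) := by
        refine lintegral_mono_ae ?_
        filter_upwards [hpos] with u hu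
        rw [lintegral_prod_prod_exp_eq hβ, Finset.prod_pow]
        refine (Finset.prod_le_pow_card _ _ _ fun k _ =>
          hB _ (hβ.isBrownianReal_coord k).toIsPreBrownianReal u (fun i => y i k) hu).trans ?_
        simp
    _ = ∏ i, ∫⁻ a in Set.Ioi (0 : ℝ), ENNReal.ofReal ((√(1 + 2 * a * v i))⁻¹) ^ 4 :=
        lintegral_pi_fin_prod _ (f := fun i a => ENNReal.ofReal ((√(1 + 2 * a * v i))⁻¹) ^ 4)
          (by fun_prop)
    _ ≤ ∏ i, (2 * (v i : ℝ≥0∞))⁻¹ :=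
        Finset.prod_le_prod' fun i _ => lintegral_inv_sqrt_pow_four_le (v i)

theorem lintegral_prod_inv_enorm_sub_sq_le_sq_right {Ω : Type*} [MeasurableSpace Ω] {P : Measure Ω}
    [IsProbabilityMeasure P] {β β' : ℝ≥0 → Ω → EuclideanSpace ℝ (Fin 4)}
    (hβ : IsStdBrownian β P) (hβ' : IsStdBrownian β' P)
    (hind : IndepFun (fun (ω : Ω) (t : ℝ≥0) => β t ω) (fun (ω : Ω) (t : ℝ≥0) => β' t ω) P)
    {n : ℕ} (s t : Fin n → ℝ≥0) :
    ∫⁻ ω, ∏ i, 1 / ‖β (s i) ω - β' (t i) ω‖ₑ ^ 2 ∂P ≤ gapProduct n (fun i => t i) ^ 2 := by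
  have hV : AEMeasurable (fun ω i => β (s i) ω) P :=
    aemeasurable_pi_lambda _ fun i => hβ.aemeasurable _
  have hW : AEMeasurable (fun ω i => β' (t i) ω) P :=
    aemeasurable_pi_lambda _ fun i => hβ'.aemeasurable _
  have hVW : IndepFun (fun ω i => β (s i) ω) (fun ω i => β' (t i) ω) P :=
    hind.comp (φ := fun (x : ℝ≥0 → EuclideanSpace ℝ (Fin 4)) i => x (s i))
      (ψ := fun (x : ℝ≥0 → EuclideanSpace ℝ (Fin 4)) i => x (t i)) (by fun_prop) (by fun_prop)
  have hf : Measurable (Function.uncurry fun x z : Fin n → EuclideanSpace ℝ (Fin 4) =>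
      ∏ i, 1 / ‖x i - z i‖ₑ ^ 2) := by
    simp only [Function.uncurry_def]; fun_prop
  rw [lintegral_of_indepFun hV hW hVW hf]
  calc _ ≤ ∫⁻ ω, gapProduct n (fun i => t i) ^ 2 ∂P := by
        refine lintegral_mono fun ω => ?_
        rw [lintegral_map' (hf.of_uncurry_left (x := fun i => β (s i) ω)).aemeasurable hW]
        refine le_trans (le_of_eq ?_)
          (lintegral_prod_inv_enorm_sub_sq_le hβ' t fun i => β (s i) ω)
        refine lintegral_congr fun ω' => Finset.prod_congr rfl fun i _ => ?_
        rw [← enorm_neg, neg_sub]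
    _ = _ := by simp

/-- Either motion may be frozen, so the squares of both gap products are upper bounds, and the
smaller square is at most the product. This halves the exponent of every singularity and makes it
integrable. -/
theorem lintegral_prod_inv_enorm_sub_sq_le_mul {Ω : Type*} [MeasurableSpace Ω] {P : Measure Ω}
    [IsProbabilityMeasure P] {β β' : ℝ≥0 → Ω → EuclideanSpace ℝ (Fin 4)}
    (hβ : IsStdBrownian β P) (hβ' : IsStdBrownian β' P)
    (hind : IndepFun (fun (ω : Ω) (t : ℝ≥0) => β t ω) (fun (ω : Ω) (t : ℝ≥0) => β' t ω) P)
    {n : ℕ} (s t : Fin n → ℝ≥0) :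
    ∫⁻ ω, ∏ i, 1 / ‖β (s i) ω - β' (t i) ω‖ₑ ^ 2 ∂P ≤
      gapProduct n (fun i => s i) * gapProduct n (fun i => t i) := by
  have h1 := lintegral_prod_inv_enorm_sub_sq_le_sq_right hβ hβ' hind s t
  have h2 := lintegral_prod_inv_enorm_sub_sq_le_sq_right hβ' hβ hind.symm t s
  have h3 : ∫⁻ ω, ∏ i, 1 / ‖β' (t i) ω - β (s i) ω‖ₑ ^ 2 ∂P =
      ∫⁻ ω, ∏ i, 1 / ‖β (s i) ω - β' (t i) ω‖ₑ ^ 2 ∂P :=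
    lintegral_congr fun ω' => Finset.prod_congr rfl fun i _ => by rw [← enorm_neg, neg_sub]
  rw [h3] at h2
  rcases le_total (gapProduct n fun i => (s i : ℝ)) (gapProduct n fun i => (t i : ℝ)) with h | h
  · refine h2.trans ?_
    rw [sq]; gcongr
  · refine h1.trans ?_
    rw [sq]; gcongr

/-! ### Joint measurability -/

/-- A real Brownian motion is indistinguishable from a jointly measurable process. -/
theorem exists_measurable_modification {Ω : Type*} [MeasurableSpace Ω] {P : Measure Ω}
    {B : ℝ≥0 → Ω → ℝ} (hB : IsBrownianReal B P) :
    ∃ G : Ω × ℝ≥0 → ℝ, Measurable G ∧ ∀ᵐ ω ∂P, ∀ t, G (ω, t) = B t ω := by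
  choose g hg hBg using fun m k : ℕ => hB.aemeasurable ((k : ℝ≥0) / m)
  have hF : ∀ m : ℕ, Measurable fun p : Ω × ℝ≥0 => g m ⌊(p.2 : ℝ) * m⌋₊ p.1 := by
    intro m
    have h1 : Measurable fun p : Ω × ℕ => g m p.2 p.1 :=
      measurable_from_prod_countable_left fun k => hg m k
    have h2 : Measurable fun p : Ω × ℝ≥0 => (p.1, ⌊(p.2 : ℝ) * m⌋₊) := by
      refine measurable_fst.prodMk (Nat.measurable_floor.comp ?_)
      fun_prop
    exact Measurable.comp (g := fun p : Ω × ℕ => g m p.2 p.1) h1 h2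
  -- Only countably many times `k / m` are used, so one null set suffices; path continuity
  -- identifies the limit at every `t` simultaneously.
  refine ⟨fun p => Filter.limsup (fun m : ℕ => g m ⌊(p.2 : ℝ) * m⌋₊ p.1) Filter.atTop,
    Measurable.limsup hF, ?_⟩
  filter_upwards [ae_all_iff.2 fun m => ae_all_iff.2 fun k => hBg m k, hB.cont] with ω h1 h2 t
  refine Filter.Tendsto.limsup_eq ?_
  have h3 : Filter.Tendsto (fun m : ℕ => (⌊(t : ℝ) * m⌋₊ : ℝ≥0) / m) Filter.atTop (nhds t) := by
    rw [← NNReal.tendsto_coe]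
    have := (tendsto_nat_floor_mul_div_atTop (R := ℝ) t.2).comp tendsto_natCast_atTop_atTop
    simpa [Function.comp_def] using this
  exact ((h2.tendsto t).comp h3).congr fun m => h1 m _

theorem IsStdBrownian.exists_measurable_modification {Ω : Type*} [MeasurableSpace Ω]
    {P : Measure Ω} {d : ℕ} {β : ℝ≥0 → Ω → EuclideanSpace ℝ (Fin d)} (hβ : IsStdBrownian β P) :
    ∃ G : Ω × ℝ≥0 → EuclideanSpace ℝ (Fin d), Measurable G ∧ ∀ᵐ ω ∂P, ∀ t, G (ω, t) = β t ω := by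
  choose G hG h using fun k =>
    BrownianCross.exists_measurable_modification (hβ.isBrownianReal_coord k)
  refine ⟨fun p => WithLp.toLp 2 fun k => G k p,
    (WithLp.measurable_toLp 2 (Fin d → ℝ)).comp (measurable_pi_lambda _ hG), ?_⟩
  filter_upwards [ae_all_iff.2 h] with ω hω t
  ext k
  exact hω k t

/-- The cross integral of jointly measurable processes. -/
noncomputable def measurableCrossIntegral {Ω : Type*} {d : ℕ}
    (G G' : Ω × ℝ≥0 → EuclideanSpace ℝ (Fin d)) (ω : Ω) : ℝ≥0∞ :=
  ∫⁻ s in Set.Icc (0 : ℝ) 1, ∫⁻ t in Set.Icc (0 : ℝ) 1,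
    1 / ‖G (ω, s.toNNReal) - G' (ω, t.toNNReal)‖ₑ ^ 2

theorem measurable_measurableCrossIntegral {Ω : Type*} [MeasurableSpace Ω] {d : ℕ}
    {G G' : Ω × ℝ≥0 → EuclideanSpace ℝ (Fin d)} (hG : Measurable G) (hG' : Measurable G') :
    Measurable (measurableCrossIntegral G G') := by
  have h : Measurable fun p : (Ω × ℝ) × ℝ =>
      1 / ‖G (p.1.1, p.1.2.toNNReal) - G' (p.1.1, p.2.toNNReal)‖ₑ ^ 2 := by fun_prop
  exact h.lintegral_prod_right'.lintegral_prod_right'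

theorem IsStdBrownian.aemeasurable_crossIntegral {Ω : Type*} [MeasurableSpace Ω] {P : Measure Ω}
    {d : ℕ} {β β' : ℝ≥0 → Ω → EuclideanSpace ℝ (Fin d)}
    (hβ : IsStdBrownian β P) (hβ' : IsStdBrownian β' P) :
    AEMeasurable (crossIntegral β β') P := by
  obtain ⟨G, hG, h⟩ := hβ.exists_measurable_modification
  obtain ⟨G', hG', h'⟩ := hβ'.exists_measurable_modification
  refine ⟨_, measurable_measurableCrossIntegral hG hG', ?_⟩
  filter_upwards [h, h'] with ω h1 h2
  simp only [crossIntegral, measurableCrossIntegral, h1, h2]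

/-! ### The moments as multiple integrals -/

theorem lintegral_lintegral_pow {α : Type*} [MeasurableSpace α] (μ : Measure α) [SigmaFinite μ]
    {f : α → α → ℝ≥0∞} (hf : Measurable (Function.uncurry f)) (n : ℕ) :
    (∫⁻ s, ∫⁻ t, f s t ∂μ ∂μ) ^ n =
      ∫⁻ s, ∫⁻ t, ∏ i, f (s i) (t i) ∂(Measure.pi fun _ : Fin n => μ)
        ∂(Measure.pi fun _ : Fin n => μ) := by
  have h1 : ∀ s, Measurable (f s) := fun s => hf.of_uncurry_left
  have h2 : Measurable fun s => ∫⁻ t, f s t ∂μ := hf.lintegral_prod_right'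
  calc (∫⁻ s, ∫⁻ t, f s t ∂μ ∂μ) ^ n = ∏ _i : Fin n, ∫⁻ s, ∫⁻ t, f s t ∂μ ∂μ := by simp
    _ = ∫⁻ s, ∏ i, ∫⁻ t, f (s i) t ∂μ ∂(Measure.pi fun _ : Fin n => μ) :=
        (lintegral_pi_fin_prod μ fun _ => h2).symm
    _ = _ := lintegral_congr fun s => (lintegral_pi_fin_prod μ fun i => h1 (s i)).symm

theorem lintegral_lintegral_lintegral_rotate {Ω S : Type*} [MeasurableSpace Ω]
    [MeasurableSpace S] {P : Measure Ω} [SFinite P] {ν : Measure S} [SFinite ν]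
    {F : Ω → S → S → ℝ≥0∞} (hF : Measurable fun p : (Ω × S) × S => F p.1.1 p.1.2 p.2) :
    ∫⁻ ω, ∫⁻ s, ∫⁻ t, F ω s t ∂ν ∂ν ∂P = ∫⁻ s, ∫⁻ t, ∫⁻ ω, F ω s t ∂P ∂ν ∂ν := by
  have h1 : Measurable (Function.uncurry fun ω s => ∫⁻ t, F ω s t ∂ν) := hF.lintegral_prod_right'
  have h2 : ∀ s, Measurable (Function.uncurry fun ω t => F ω s t) := fun s => by
    have : Measurable fun p : Ω × S => ((p.1, s), p.2) := by fun_prop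
    exact hF.comp this
  rw [lintegral_lintegral_swap h1.aemeasurable]
  exact lintegral_congr fun s => lintegral_lintegral_swap (h2 s).aemeasurable

theorem lintegral_measurableCrossIntegral_pow {Ω : Type*} [MeasurableSpace Ω] {P : Measure Ω}
    [SFinite P] {d : ℕ} {G G' : Ω × ℝ≥0 → EuclideanSpace ℝ (Fin d)} (hG : Measurable G)
    (hG' : Measurable G') (n : ℕ) :
    ∫⁻ ω, measurableCrossIntegral G G' ω ^ n ∂P =
      ∫⁻ s, ∫⁻ t, ∫⁻ ω, ∏ i, 1 / ‖G (ω, (s i).toNNReal) - G' (ω, (t i).toNNReal)‖ₑ ^ 2 ∂P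
        ∂(Measure.pi fun _ : Fin n => volume.restrict (Set.Icc (0 : ℝ) 1))
        ∂(Measure.pi fun _ : Fin n => volume.restrict (Set.Icc (0 : ℝ) 1)) := by
  have hm : Measurable fun p : (Ω × (Fin n → ℝ)) × (Fin n → ℝ) =>
      ∏ i, 1 / ‖G (p.1.1, (p.1.2 i).toNNReal) - G' (p.1.1, (p.2 i).toNNReal)‖ₑ ^ 2 := by
    fun_prop
  rw [← lintegral_lintegral_lintegral_rotate (ν := Measure.pi fun _ : Fin n =>
    volume.restrict (Set.Icc (0 : ℝ) 1)) (F := fun ω (s t : Fin n → ℝ) =>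
    ∏ i, 1 / ‖G (ω, (s i).toNNReal) - G' (ω, (t i).toNNReal)‖ₑ ^ 2) hm]
  refine lintegral_congr fun ω => ?_
  have hf : Measurable (Function.uncurry fun s t : ℝ =>
      1 / ‖G (ω, s.toNNReal) - G' (ω, t.toNNReal)‖ₑ ^ 2) := by
    simp only [Function.uncurry_def]; fun_prop
  exact lintegral_lintegral_pow _ hf n

/-! ### Integrating the gap weights -/

@[fun_prop]
theorem measurable_gapWeight {n : ℕ} :
    Measurable fun p : ℝ × (Fin n → ℝ) => gapWeight p.1 p.2 := by
  simp only [gapWeight, Fin.sum_univ_succ, Fin.cons_zero, Fin.cons_succ]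
  fun_prop

theorem measurable_gapProduct (n : ℕ) : Measurable (gapProduct n) := by
  induction n with
  | zero => exact measurable_const
  | succ n ih =>
    have h : Measurable fun s : Fin (n + 1) → ℝ => (s 0, Fin.tail s) :=
      (measurable_pi_apply 0).prodMk (measurable_pi_lambda _ fun i => measurable_pi_apply i.succ)
    exact (measurable_gapWeight.comp h).mul (ih.comp (measurable_snd.comp h))

/-- Within distance `1` of `r` the integral is at most that of the singularity over `[-1, 1]`, by
translation; beyond it the integrand is at most `1`. Hence a bound independent of `r`. -/
theorem exists_lintegral_rpow_abs_sub_le :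
    ∃ A : ℝ, 1 ≤ A ∧ ∀ r : ℝ,
      ∫⁻ x in Set.Icc (0 : ℝ) 1, ENNReal.ofReal |x - r| ^ (-(1 / 2) : ℝ) ≤ ENNReal.ofReal A := by
  set J : ℝ≥0∞ := ∫⁻ x in Set.Icc (0 : ℝ) 1, ENNReal.ofReal |x| ^ (-(1 / 2) : ℝ) with hJ
  have hJfin : J ≠ ∞ := by
    have h1 : IntegrableOn (fun x : ℝ => x ^ (-(1 / 2) : ℝ)) (Set.Ioc 0 1) :=
      (intervalIntegrable_iff_integrableOn_Ioc_of_le zero_le_one).1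
        (intervalIntegral.intervalIntegrable_rpow' (by norm_num))
    have h2 : J = ∫⁻ x in Set.Ioc (0 : ℝ) 1, ENNReal.ofReal (x ^ (-(1 / 2) : ℝ)) := by
      rw [hJ, setLIntegral_congr Ioc_ae_eq_Icc.symm]
      refine setLIntegral_congr_fun measurableSet_Ioc fun x hx => ?_
      have hx : 0 < x := hx.1
      simp only [abs_of_pos hx, ENNReal.ofReal_rpow_of_pos hx]
    rw [h2]
    exact (h1.lintegral_lt_top).ne
  have hneg : ∫⁻ x in Set.Icc (-1 : ℝ) 0, ENNReal.ofReal |x| ^ (-(1 / 2) : ℝ) = J := by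
    have h := (Measure.measurePreserving_neg (volume : Measure ℝ)).setLIntegral_comp_preimage
      (s := Set.Icc (0 : ℝ) 1) measurableSet_Icc
      (f := fun x : ℝ => ENNReal.ofReal |x| ^ (-(1 / 2) : ℝ)) (by fun_prop)
    rw [hJ]
    simpa using h
  set φ : ℝ → ℝ≥0∞ := (Set.Icc (-1 : ℝ) 1).indicator
    fun x => ENNReal.ofReal |x| ^ (-(1 / 2) : ℝ) with hφ
  have hφm : Measurable φ := by
    refine Measurable.indicator ?_ measurableSet_Icc
    fun_prop
  have hφJ : ∫⁻ x, φ x ≤ J + J := by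
    rw [hφ, lintegral_indicator measurableSet_Icc]
    calc _ ≤ ∫⁻ x in Set.Icc (-1 : ℝ) 0 ∪ Set.Icc 0 1, ENNReal.ofReal |x| ^ (-(1 / 2) : ℝ) := by
          refine lintegral_mono_set fun x hx => ?_
          rcases le_total x 0 with h | h
          · exact Or.inl ⟨hx.1, h⟩
          · exact Or.inr ⟨h, hx.2⟩
      _ ≤ _ := (lintegral_union_le _ _ _).trans (by rw [hneg])
  refine ⟨(J + J).toReal + 1, by simp, fun r => ?_⟩
  rw [ENNReal.ofReal_add ENNReal.toReal_nonneg zero_le_one,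
    ENNReal.ofReal_toReal (ENNReal.add_ne_top.2 ⟨hJfin, hJfin⟩), ENNReal.ofReal_one]
  have hle : ∀ x : ℝ, ENNReal.ofReal |x - r| ^ (-(1 / 2) : ℝ) ≤ φ (x - r) + 1 := by
    intro x
    by_cases hx : x - r ∈ Set.Icc (-1 : ℝ) 1
    · rw [hφ, Set.indicator_of_mem hx]; exact le_self_add
    · refine le_trans ?_ le_add_self
      have h1 : 1 ≤ |x - r| := by
        by_contra h
        exact hx (abs_le.1 (not_le.1 h).le)
      rw [ENNReal.rpow_neg, ENNReal.inv_le_one]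
      exact ENNReal.one_le_rpow (ENNReal.one_le_ofReal.2 h1) (by norm_num)
  calc _ ≤ ∫⁻ x in Set.Icc (0 : ℝ) 1, (φ (x - r) + 1) := lintegral_mono fun x => hle x
    _ = (∫⁻ x in Set.Icc (0 : ℝ) 1, φ (x - r)) + 1 := by
        rw [lintegral_add_right _ measurable_const]; simp
    _ ≤ (∫⁻ x, φ (x - r)) + 1 := by gcongr; exact Measure.restrict_le_self
    _ = (∫⁻ x, φ x) + 1 := by rw [lintegral_sub_right_eq_self]
    _ ≤ _ := by gcongr

/-- Integrate the first time with the others fixed: its weight has one singularity at each of `n +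
1` points, each costing at most `A`. Iterating produces the factorial. -/
theorem lintegral_gapProduct_le {A : ℝ≥0∞} (hA : ∀ r : ℝ,
      ∫⁻ x in Set.Icc (0 : ℝ) 1, ENNReal.ofReal |x - r| ^ (-(1 / 2) : ℝ) ≤ A) (n : ℕ) :
    ∫⁻ s, gapProduct n s ∂(Measure.pi fun _ => volume.restrict (Set.Icc (0 : ℝ) 1)) ≤
      A ^ n * n.factorial := by
  induction n with
  | zero => simp [gapProduct]
  | succ n ih =>
    have h1 : ∀ y : Fin n → ℝ, ∫⁻ a in Set.Icc (0 : ℝ) 1, gapWeight a y ≤ (n + 1) * A := by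
      intro y
      simp only [gapWeight]
      rw [lintegral_finsetSum _ fun k _ => by fun_prop]
      refine (Finset.sum_le_card_nsmul _ _ A fun k _ => hA _).trans (le_of_eq ?_)
      simp
    rw [lintegral_pi_fin_succ _ (measurable_gapProduct _)]
    simp only [gapProduct, Fin.cons_zero, Fin.tail_cons]
    calc _ ≤ ∫⁻ y, ((n + 1) * A) * gapProduct n y
          ∂(Measure.pi fun _ => volume.restrict (Set.Icc (0 : ℝ) 1)) := by
          refine lintegral_mono fun y => ?_
          have hm : Measurable fun a : ℝ => gapWeight a y := by fun_prop
          rw [lintegral_mul_const _ hm]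
          gcongr
          exact h1 y
      _ ≤ ((n + 1) * A) * (A ^ n * n.factorial) := by
          rw [lintegral_const_mul _ (measurable_gapProduct n)]
          gcongr
      _ = _ := by rw [Nat.factorial_succ]; push_cast; ring

theorem lintegral_crossIntegral_pow_le {Ω : Type*} [MeasurableSpace Ω] {P : Measure Ω}
    [IsProbabilityMeasure P] {β β' : ℝ≥0 → Ω → EuclideanSpace ℝ (Fin 4)}
    (hβ : IsStdBrownian β P) (hβ' : IsStdBrownian β' P)
    (hind : IndepFun (fun (ω : Ω) (t : ℝ≥0) => β t ω) (fun (ω : Ω) (t : ℝ≥0) => β' t ω) P)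
    {A : ℝ≥0∞} (hA : ∀ r : ℝ,
      ∫⁻ x in Set.Icc (0 : ℝ) 1, ENNReal.ofReal |x - r| ^ (-(1 / 2) : ℝ) ≤ A) (n : ℕ) :
    ∫⁻ ω, crossIntegral β β' ω ^ n ∂P ≤ (A ^ n * n.factorial) ^ 2 := by
  obtain ⟨G, hG, h⟩ := hβ.exists_measurable_modification
  obtain ⟨G', hG', h'⟩ := hβ'.exists_measurable_modification
  have h1 : ∫⁻ ω, crossIntegral β β' ω ^ n ∂P = ∫⁻ ω, measurableCrossIntegral G G' ω ^ n ∂P := by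
    refine lintegral_congr_ae ?_
    filter_upwards [h, h'] with ω h1 h2
    simp only [crossIntegral, measurableCrossIntegral, h1, h2]
  rw [h1, lintegral_measurableCrossIntegral_pow hG hG']
  have hpos : ∀ᵐ s ∂(Measure.pi fun _ : Fin n => volume.restrict (Set.Icc (0 : ℝ) 1)),
      ∀ i, ((s i).toNNReal : ℝ) = s i := by
    refine ae_all_iff.2 fun i => ?_
    have h1 : ∀ᵐ a ∂volume.restrict (Set.Icc (0 : ℝ) 1), (a.toNNReal : ℝ) = a := by
      filter_upwards [ae_restrict_mem measurableSet_Icc] with a ha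
      exact Real.coe_toNNReal a ha.1
    exact (Measure.tendsto_eval_ae_ae (μ := fun _ : Fin n => volume.restrict (Set.Icc (0 : ℝ) 1))
      (i := i)).eventually h1
  set ν : Measure (Fin n → ℝ) :=
    Measure.pi fun _ : Fin n => volume.restrict (Set.Icc (0 : ℝ) 1)
  calc _ ≤ ∫⁻ s, ∫⁻ t, gapProduct n s * gapProduct n t ∂ν ∂ν := by
        refine lintegral_mono_ae ?_
        filter_upwards [hpos] with s hs
        refine lintegral_mono_ae ?_
        filter_upwards [hpos] with t ht
        have h2 := lintegral_prod_inv_enorm_sub_sq_le_mul hβ hβ' hind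
          (fun i => (s i).toNNReal) (fun i => (t i).toNNReal)
        simp only [hs, ht] at h2
        refine le_trans (le_of_eq (lintegral_congr_ae ?_)) h2
        filter_upwards [h, h'] with ω h3 h4
        simp only [h3, h4]
    _ = (∫⁻ s, gapProduct n s ∂ν) * ∫⁻ t, gapProduct n t ∂ν := by
        simp only [lintegral_const_mul _ (measurable_gapProduct n)]
        rw [lintegral_mul_const _ (measurable_gapProduct n)]
    _ ≤ _ := by
        rw [sq]
        gcongr <;> exact lintegral_gapProduct_le hA n

/-! ### Exponential functionals along a grid -/

/-- Integrating out the last increment turns the terminal weight `b` into `b / (1 + 2 b δ)` at the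
previous grid point, which also carries the weight `a`. The condition `hab` says that the total is
again at most `b`, so each step costs only the constant factor. -/
theorem pow_le_lintegral_exp_neg_grid {Ω : Type*} [MeasurableSpace Ω] {P : Measure Ω}
    [IsProbabilityMeasure P] {B : ℝ≥0 → Ω → ℝ} (hB : IsPreBrownianReal B P) (δ : ℝ≥0) {a b : ℝ}
    (hb : 0 ≤ b) (hab : b / (1 + 2 * b * δ) + a ≤ b) (k : ℕ) :
    ENNReal.ofReal ((√(1 + 2 * b * δ))⁻¹) ^ k ≤
      ∫⁻ ω, ENNReal.ofReal (Real.exp (-(a * ∑ j ∈ Finset.range k, B (j * δ) ω ^ 2 +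
        b * B (k * δ) ω ^ 2))) ∂P := by
  induction k with
  | zero =>
    have h : ∀ᵐ ω ∂P, ENNReal.ofReal (Real.exp (-(a * ∑ j ∈ Finset.range 0, B (j * δ) ω ^ 2 +
        b * B ((0 : ℕ) * δ) ω ^ 2))) = 1 := by
      filter_upwards [hB.eval_zero_ae_eq_zero] with ω hω
      simp [hω]
    rw [lintegral_congr_ae h]
    simp
  | succ k ih =>
    let τ : Fin (k + 1) → ℝ≥0 := fun j => (j : ℕ) * δ
    -- With coefficients `1` and `0` the prediction error is the increment over the last step, of
    -- variance `δ`.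
    obtain ⟨hlaw, hind⟩ := predictor_error_hasLaw_indepFun hB τ ((k + 1 : ℕ) * δ) (Fin.last k)
      (Fin.last k) 1 0 δ (fun r => by
        have h1 : ((r : ℕ) : ℝ≥0) ≤ k := by exact_mod_cast Nat.lt_succ_iff.1 r.2
        have h2 : ((r : ℕ) : ℝ≥0) * δ ≤ k * δ := by gcongr
        have h3 : (k : ℝ≥0) * δ ≤ (k + 1 : ℕ) * δ := by gcongr; simp
        simp only [τ, Fin.val_last]
        rw [min_eq_right (h2.trans h3), min_eq_right h2]
        ring) (by
        have h3 : (k : ℝ≥0) * δ ≤ (k + 1 : ℕ) * δ := by gcongr; simp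
        simp only [τ, Fin.val_last]
        rw [min_eq_left h3]
        push_cast
        ring)
    have hV : AEMeasurable (fun ω r => B (τ r) ω) P :=
      aemeasurable_pi_lambda _ fun r => hB.aemeasurable _
    have key := lintegral_mul_exp_neg_mul_sq_of_indepFun hV hlaw hind
      (g := fun x => ENNReal.ofReal (Real.exp (-(a * ∑ j, x j ^ 2))))
      (by fun_prop) (h := fun x => x (Fin.last k)) (by fun_prop) hb
    calc _ ≤ ENNReal.ofReal ((√(1 + 2 * b * δ))⁻¹) *
          ∫⁻ ω, ENNReal.ofReal (Real.exp (-(a * ∑ j, B (τ j) ω ^ 2))) *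
            ENNReal.ofReal (Real.exp (-(b / (1 + 2 * b * δ) * B (τ (Fin.last k)) ω ^ 2))) ∂P := by
          rw [pow_succ']
          gcongr
          refine ih.trans (lintegral_mono fun ω => ?_)
          rw [← ENNReal.ofReal_mul (Real.exp_pos _).le, ← Real.exp_add]
          refine ENNReal.ofReal_le_ofReal (Real.exp_le_exp.2 ?_)
          rw [Fin.sum_univ_eq_sum_range (fun j => B (j * δ) ω ^ 2) (k + 1),
            Finset.sum_range_succ]
          simp only [τ, Fin.val_last]
          nlinarith [mul_le_mul_of_nonneg_right hab (sq_nonneg (B (k * δ) ω))]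
      _ = _ := by
          rw [← key]
          refine lintegral_congr fun ω => ?_
          rw [← ENNReal.ofReal_mul (Real.exp_pos _).le, ← Real.exp_add,
            Fin.sum_univ_eq_sum_range (fun j => B (j * δ) ω ^ 2) (k + 1)]
          congr 2
          ring

/-- The grid recursion with `δ = 1 / m` and `a = b² / m`: the hypothesis `2 * b ≤ m` ensures its
weight condition, and `1 + x ≤ exp x` turns `(1 + 2 b / m)^(-m/2)` into `exp (-b)`. The nonnegative
terminal weight is then dropped. -/
theorem exp_neg_le_lintegral_exp_neg_grid {Ω : Type*} [MeasurableSpace Ω] {P : Measure Ω}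
    [IsProbabilityMeasure P] {B : ℝ≥0 → Ω → ℝ} (hB : IsPreBrownianReal B P) {b : ℝ}
    (hb : 0 ≤ b) {m : ℕ} (hm0 : 0 < m) (hm : 2 * b ≤ m) :
    ENNReal.ofReal (Real.exp (-b)) ≤
      ∫⁻ ω, ENNReal.ofReal (Real.exp (-(b ^ 2 * ((m : ℝ)⁻¹ *
        ∑ j ∈ Finset.range m, B (j / m) ω ^ 2)))) ∂P := by
  have hm0' : (0 : ℝ) < m := by exact_mod_cast hm0
  have hpos : 0 < 1 + 2 * b * ((m : ℝ≥0)⁻¹ : ℝ≥0) := by positivity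
  have h1 : b / (1 + 2 * b * ((m : ℝ≥0)⁻¹ : ℝ≥0)) + b ^ 2 * (m : ℝ)⁻¹ ≤ b := by
    have h2 : 1 + 2 * b * (m : ℝ)⁻¹ ≤ 2 := by
      have : 2 * b * (m : ℝ)⁻¹ ≤ 1 := by rw [← div_eq_mul_inv]; exact (div_le_one hm0').2 hm
      linarith
    have h3 : b - b / (1 + 2 * b * ((m : ℝ≥0)⁻¹ : ℝ≥0)) =
        2 * b ^ 2 * (m : ℝ)⁻¹ / (1 + 2 * b * (m : ℝ)⁻¹) := by
      have : (1 + 2 * b * (m : ℝ)⁻¹) ≠ 0 := by positivity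
      push_cast
      field_simp
      ring
    have h4 : b ^ 2 * (m : ℝ)⁻¹ ≤ 2 * b ^ 2 * (m : ℝ)⁻¹ / (1 + 2 * b * (m : ℝ)⁻¹) := by
      rw [le_div_iff₀ (by positivity)]
      have : 0 ≤ b ^ 2 * (m : ℝ)⁻¹ := by positivity
      nlinarith
    linarith
  have key := pow_le_lintegral_exp_neg_grid hB ((m : ℝ≥0)⁻¹) hb h1 m
  calc ENNReal.ofReal (Real.exp (-b))
      ≤ ENNReal.ofReal ((√(1 + 2 * b * ((m : ℝ≥0)⁻¹ : ℝ≥0)))⁻¹) ^ m := by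
        rw [← ENNReal.ofReal_pow (by positivity)]
        refine ENNReal.ofReal_le_ofReal ?_
        have h5 : Real.exp (-b) = (Real.exp (-(b * (m : ℝ)⁻¹))) ^ m := by
          rw [← Real.exp_nat_mul]; congr 1; field_simp
        rw [h5]
        refine pow_le_pow_left₀ (Real.exp_pos _).le ?_ m
        rw [Real.exp_neg]
        refine inv_anti₀ (by positivity) ?_
        rw [Real.sqrt_le_left (Real.exp_pos _).le, ← Real.exp_nat_mul]
        have := Real.add_one_le_exp (((2 : ℕ) : ℝ) * (b * (m : ℝ)⁻¹))
        push_cast at this ⊢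
        linarith
    _ ≤ _ := key
    _ ≤ _ := by
        refine lintegral_mono fun ω => ENNReal.ofReal_le_ofReal (Real.exp_le_exp.2 ?_)
        simp only [← div_eq_mul_inv]
        have : 0 ≤ b * B (m / m) ω ^ 2 := by positivity
        have h6 : b ^ 2 * ((m : ℝ)⁻¹ * ∑ j ∈ Finset.range m, B (j / m) ω ^ 2) =
          b ^ 2 / m * ∑ j ∈ Finset.range m, B (j / m) ω ^ 2 := by field_simp
        rw [h6]
        linarith

theorem IsStdBrownian.exp_neg_pow_le_lintegral_grid {Ω : Type*} [MeasurableSpace Ω]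
    {P : Measure Ω} [IsProbabilityMeasure P] {d : ℕ} {β : ℝ≥0 → Ω → EuclideanSpace ℝ (Fin d)}
    (hβ : IsStdBrownian β P) {b : ℝ} (hb : 0 ≤ b) {m : ℕ} (hm0 : 0 < m) (hm : 2 * b ≤ m) :
    ENNReal.ofReal (Real.exp (-b)) ^ d ≤
      ∫⁻ ω, ENNReal.ofReal (Real.exp (-(b ^ 2 * ((m : ℝ)⁻¹ *
        ∑ j ∈ Finset.range m, ‖β (j / m) ω‖ ^ 2)))) ∂P := by
  have hind : iIndepFun (fun (k : Fin d) ω => ENNReal.ofReal (Real.exp (-(b ^ 2 * ((m : ℝ)⁻¹ *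
        ∑ j ∈ Finset.range m, β (j / m) ω k ^ 2))))) P :=
    hβ.iIndepFun_coord.comp
      (fun k x => ENNReal.ofReal (Real.exp (-(b ^ 2 * ((m : ℝ)⁻¹ *
        ∑ j ∈ Finset.range m, x (j / m) ^ 2)))))
      fun k => by fun_prop
  have hm : ∀ k : Fin d, AEMeasurable (fun ω => ENNReal.ofReal (Real.exp (-(b ^ 2 * ((m : ℝ)⁻¹ *
        ∑ j ∈ Finset.range m, β (j / m) ω k ^ 2))))) P := fun k => by
    have h1 : ∀ t, AEMeasurable (fun ω => β t ω k) P :=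
      fun t => (hβ.isBrownianReal_coord k).aemeasurable _
    fun_prop
  calc ENNReal.ofReal (Real.exp (-b)) ^ d = ∏ _k : Fin d, ENNReal.ofReal (Real.exp (-b)) := by simp
    _ ≤ _ := Finset.prod_le_prod' fun k _ => exp_neg_le_lintegral_exp_neg_grid
          (hβ.isBrownianReal_coord k).toIsPreBrownianReal hb hm0 ‹_›
    _ = _ := by
      rw [← lintegral_prod_of_iIndepFun hind hm]
      refine lintegral_congr fun ω => ?_
      rw [← ENNReal.ofReal_prod_of_nonneg fun _ _ => (Real.exp_pos _).le, ← Real.exp_sum]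
      congr 2
      simp only [EuclideanSpace.real_norm_sq_eq]
      rw [Finset.sum_comm, Finset.mul_sum, Finset.mul_sum, Finset.sum_neg_distrib]

/-! ### Riemann sums -/

theorem tendsto_left_riemannSum {f : ℝ → ℝ} (hf : Continuous f) :
    Filter.Tendsto (fun m : ℕ => (m : ℝ)⁻¹ * ∑ j ∈ Finset.range m, f (j / m)) Filter.atTop
      (nhds (∫ x in (0 : ℝ)..1, f x)) := by
  rw [Metric.tendsto_atTop]
  intro ε hε
  have huc := isCompact_Icc.uniformContinuousOn_of_continuous (s := Set.Icc (0 : ℝ) 1)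
    hf.continuousOn
  rw [Metric.uniformContinuousOn_iff] at huc
  obtain ⟨δ, hδ, h⟩ := huc (ε / 2) (by positivity)
  obtain ⟨N, hN⟩ := exists_nat_gt (1 / δ)
  refine ⟨max N 1, fun m hm => ?_⟩
  have hm1 : 1 ≤ m := (le_max_right _ _).trans hm
  have hm0 : (0 : ℝ) < m := by exact_mod_cast hm1
  have hmδ : (m : ℝ)⁻¹ < δ := by
    have : 1 / δ < m := hN.trans_le (by exact_mod_cast (le_max_left _ _).trans hm)
    rw [inv_lt_comm₀ hm0 hδ]
    simpa using this
  have hsum := intervalIntegral.sum_integral_adjacent_intervals (f := f) (μ := volume)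
    (a := fun j : ℕ => (j : ℝ) / m) (n := m) fun k _ => hf.intervalIntegrable _ _
  simp only [Nat.cast_zero, zero_div, div_self hm0.ne'] at hsum
  have hstep : ∀ j : ℕ, ((j + 1 : ℕ) : ℝ) / m - j / m = (m : ℝ)⁻¹ := fun j => by
    push_cast; field_simp; ring
  rw [← hsum, Finset.mul_sum, dist_eq_norm, ← Finset.sum_sub_distrib]
  calc _ ≤ ∑ j ∈ Finset.range m, ‖(m : ℝ)⁻¹ * f (j / m) -
          ∫ x in (j / m : ℝ)..((j + 1 : ℕ) : ℝ) / m, f x‖ := norm_sum_le _ _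
    _ ≤ ∑ j ∈ Finset.range m, ε / 2 * (m : ℝ)⁻¹ := by
        refine Finset.sum_le_sum fun j hj => ?_
        have hjm : ((j + 1 : ℕ) : ℝ) ≤ m := by exact_mod_cast Finset.mem_range.1 hj
        have hle : (j / m : ℝ) ≤ ((j + 1 : ℕ) : ℝ) / m := by gcongr; simp
        have h1 : (m : ℝ)⁻¹ * f (j / m) =
            ∫ _x in (j / m : ℝ)..((j + 1 : ℕ) : ℝ) / m, f (j / m) := by
          rw [intervalIntegral.integral_const, hstep, smul_eq_mul]
        rw [h1, ← intervalIntegral.integral_sub (by simp) (hf.intervalIntegrable _ _)]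
        refine (intervalIntegral.norm_integral_le_of_norm_le_const (C := ε / 2)
          fun x hx => ?_).trans (le_of_eq ?_)
        · rw [Set.uIoc_of_le hle] at hx
          have h0 : (0 : ℝ) ≤ j / m := by positivity
          have h1 : ((j + 1 : ℕ) : ℝ) / m ≤ 1 := (div_le_one hm0).2 hjm
          rw [← dist_eq_norm]
          refine (h _ ⟨h0, hle.trans h1⟩ _ ⟨h0.trans hx.1.le, hx.2.trans h1⟩ ?_).le
          rw [dist_comm, Real.dist_eq, abs_of_pos (by linarith [hx.1])]
          have := hstep j
          linarith [hx.2]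
        · rw [hstep, abs_of_pos (by positivity)]
    _ = ε / 2 := by simp; field_simp
    _ < ε := by linarith

/-! ### A lower bound for the cross integral of two continuous paths -/

/-- With `r = ‖x - y‖`, expand `(1/r - r/M)² ≥ 0` and use `r² ≤ 2‖x‖² + 2‖y‖²`. This is the
tangent-line bound for `1/r²`, with its negative term moved across to remain in `[0, ∞]`. -/
theorem ofReal_two_div_le {E : Type*} [NormedAddCommGroup E] {M : ℝ} (hM : 0 < M) (x y : E) :
    ENNReal.ofReal (2 / M) ≤
      1 / ‖x - y‖ₑ ^ 2 + ENNReal.ofReal ((2 * ‖x‖ ^ 2 + 2 * ‖y‖ ^ 2) / M ^ 2) := by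
  rcases (norm_nonneg (x - y)).eq_or_lt with h | h
  · have : ‖x - y‖ₑ = 0 := by rw [← ofReal_norm, ← h]; simp
    simp [this]
  · rw [one_div, ← ofReal_norm, ← ENNReal.ofReal_pow (norm_nonneg _),
      ← ENNReal.ofReal_inv_of_pos (by positivity), ← ENNReal.ofReal_add (by positivity)
      (by positivity)]
    refine ENNReal.ofReal_le_ofReal ?_
    set r := ‖x - y‖ with hr
    have h1 : r ^ 2 ≤ 2 * ‖x‖ ^ 2 + 2 * ‖y‖ ^ 2 := by
      have := norm_sub_le x y
      nlinarith [sq_nonneg (‖x‖ - ‖y‖), norm_nonneg x, norm_nonneg y]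
    have h2 : 2 / M ≤ (r ^ 2)⁻¹ + r ^ 2 / M ^ 2 := by
      have : (r ^ 2)⁻¹ + r ^ 2 / M ^ 2 - 2 / M = (r⁻¹ - r / M) ^ 2 := by field_simp; ring
      nlinarith [sq_nonneg (r⁻¹ - r / M)]
    have h3 : r ^ 2 / M ^ 2 ≤ (2 * ‖x‖ ^ 2 + 2 * ‖y‖ ^ 2) / M ^ 2 := by gcongr
    linarith

theorem lintegral_Icc_ofReal {f : ℝ → ℝ} (hf : Continuous f) (h0 : ∀ x, 0 ≤ f x) :
    ∫⁻ x in Set.Icc (0 : ℝ) 1, ENNReal.ofReal (f x) = ENNReal.ofReal (∫ x in (0 : ℝ)..1, f x) := by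
  rw [intervalIntegral.integral_of_le zero_le_one, ← integral_Icc_eq_integral_Ioc,
    ofReal_integral_eq_lintegral_ofReal
      (hf.continuousOn.integrableOn_compact isCompact_Icc) (Filter.Eventually.of_forall h0)]

/-- Integrating the tangent-line bound over the unit square gives `2/M` on one side and the cross
integral plus at most `1/M` on the other. -/
theorem ofReal_inv_le_lintegral_inv_enorm_sub_sq {E : Type*} [NormedAddCommGroup E]
    {x y : ℝ → E} (hx : Continuous x) (hy : Continuous y) {M : ℝ} (hM : 0 < M)
    (h : 2 * (∫ s in (0 : ℝ)..1, ‖x s‖ ^ 2) + 2 * ∫ t in (0 : ℝ)..1, ‖y t‖ ^ 2 ≤ M) :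
    ENNReal.ofReal (1 / M) ≤
      ∫⁻ s in Set.Icc (0 : ℝ) 1, ∫⁻ t in Set.Icc (0 : ℝ) 1, 1 / ‖x s - y t‖ₑ ^ 2 := by
  set Q' := ∫ t in (0 : ℝ)..1, ‖y t‖ ^ 2 with hQ'
  have hQ'0 : 0 ≤ Q' := intervalIntegral.integral_nonneg zero_le_one fun _ _ => by positivity
  have hinner : ∀ s, ∫⁻ t in Set.Icc (0 : ℝ) 1,
      ENNReal.ofReal ((2 * ‖x s‖ ^ 2 + 2 * ‖y t‖ ^ 2) / M ^ 2) =
        ENNReal.ofReal ((2 * ‖x s‖ ^ 2 + 2 * Q') / M ^ 2) := by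
    intro s
    rw [lintegral_Icc_ofReal (by fun_prop) fun t => by positivity]
    congr 1
    rw [intervalIntegral.integral_div, intervalIntegral.integral_add (by simp)
      ((by fun_prop : Continuous fun t => 2 * ‖y t‖ ^ 2).intervalIntegrable _ _),
      intervalIntegral.integral_const_mul]
    simp [hQ']
  have houter : ∫⁻ s in Set.Icc (0 : ℝ) 1, ENNReal.ofReal ((2 * ‖x s‖ ^ 2 + 2 * Q') / M ^ 2) ≤
      ENNReal.ofReal (1 / M) := by
    rw [lintegral_Icc_ofReal (by fun_prop) fun t => by positivity]
    refine ENNReal.ofReal_le_ofReal ?_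
    rw [intervalIntegral.integral_div, intervalIntegral.integral_add
      ((by fun_prop : Continuous fun t => 2 * ‖x t‖ ^ 2).intervalIntegrable _ _) (by simp),
      intervalIntegral.integral_const_mul]
    simp only [intervalIntegral.integral_const, sub_zero, one_smul]
    rw [div_le_div_iff₀ (by positivity) hM]
    nlinarith
  have hmeas : Measurable fun s => ENNReal.ofReal ((2 * ‖x s‖ ^ 2 + 2 * Q') / M ^ 2) :=
    (by fun_prop : Continuous fun s => (2 * ‖x s‖ ^ 2 + 2 * Q') / M ^ 2).measurable.ennreal_ofReal
  have hmeas' : ∀ s, Measurable fun t =>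
      ENNReal.ofReal ((2 * ‖x s‖ ^ 2 + 2 * ‖y t‖ ^ 2) / M ^ 2) := fun s =>
    (by fun_prop : Continuous fun t =>
      (2 * ‖x s‖ ^ 2 + 2 * ‖y t‖ ^ 2) / M ^ 2).measurable.ennreal_ofReal
  have key : ENNReal.ofReal (2 / M) ≤ (∫⁻ s in Set.Icc (0 : ℝ) 1, ∫⁻ t in Set.Icc (0 : ℝ) 1,
      1 / ‖x s - y t‖ₑ ^ 2) + ENNReal.ofReal (1 / M) := by
    calc ENNReal.ofReal (2 / M)
        = ∫⁻ _s in Set.Icc (0 : ℝ) 1, ∫⁻ _t in Set.Icc (0 : ℝ) 1, ENNReal.ofReal (2 / M) := by simp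
      _ ≤ ∫⁻ s in Set.Icc (0 : ℝ) 1, ∫⁻ t in Set.Icc (0 : ℝ) 1, (1 / ‖x s - y t‖ₑ ^ 2 +
            ENNReal.ofReal ((2 * ‖x s‖ ^ 2 + 2 * ‖y t‖ ^ 2) / M ^ 2)) :=
          lintegral_mono fun s => lintegral_mono fun t => ofReal_two_div_le hM _ _
      _ = (∫⁻ s in Set.Icc (0 : ℝ) 1, ∫⁻ t in Set.Icc (0 : ℝ) 1, 1 / ‖x s - y t‖ₑ ^ 2) +
            ∫⁻ s in Set.Icc (0 : ℝ) 1, ENNReal.ofReal ((2 * ‖x s‖ ^ 2 + 2 * Q') / M ^ 2) := by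
          rw [← lintegral_add_right _ hmeas]
          refine lintegral_congr fun s => ?_
          rw [lintegral_add_right _ (hmeas' s), hinner]
      _ ≤ _ := by gcongr
  have h2 : ENNReal.ofReal (2 / M) = ENNReal.ofReal (1 / M) + ENNReal.ofReal (1 / M) := by
    rw [← ENNReal.ofReal_add (by positivity) (by positivity)]
    congr 1; ring
  rw [h2] at key
  exact (ENNReal.add_le_add_iff_right ENNReal.ofReal_ne_top).1 key

/-! ### The lower bound for integer moments -/

theorem IsStdBrownian.ae_continuous {Ω : Type*} [MeasurableSpace Ω] {P : Measure Ω} {d : ℕ}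
    {β : ℝ≥0 → Ω → EuclideanSpace ℝ (Fin d)} (hβ : IsStdBrownian β P) :
    ∀ᵐ ω ∂P, Continuous fun t => β t ω := by
  filter_upwards [ae_all_iff.2 fun k => (hβ.isBrownianReal_coord k).cont] with ω hω
  exact (PiLp.continuous_toLp 2 (fun _ : Fin d => ℝ)).comp (continuous_pi hω)

/-- The exponential of minus `b²` times the `m`-th Riemann sum of `‖x‖²` over `[0, 1]`. -/
noncomputable def gridWeight {E : Type*} [NormedAddCommGroup E] (b : ℝ) (m : ℕ) (x : ℝ≥0 → E) :
    ℝ≥0∞ :=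
  ENNReal.ofReal (Real.exp (-(b ^ 2 * ((m : ℝ)⁻¹ * ∑ j ∈ Finset.range m, ‖x (j / m)‖ ^ 2))))

section gridWeight

variable {E : Type*} [NormedAddCommGroup E]

theorem measurable_gridWeight [MeasurableSpace E] [OpensMeasurableSpace E] (b : ℝ) (m : ℕ) :
    Measurable (gridWeight (E := E) b m) := by
  unfold gridWeight; fun_prop

theorem aemeasurable_gridWeight [MeasurableSpace E] [OpensMeasurableSpace E] {Ω : Type*}
    [MeasurableSpace Ω] {P : Measure Ω} {X : ℝ≥0 → Ω → E} (b : ℝ)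
    (hX : ∀ t, AEMeasurable (X t) P) (m : ℕ) :
    AEMeasurable (fun ω => gridWeight b m fun t => X t ω) P := by
  have h : ∀ t, AEMeasurable (fun ω => X t ω) P := hX
  unfold gridWeight
  fun_prop

theorem gridWeight_le_one (b : ℝ) (m : ℕ) (x : ℝ≥0 → E) : gridWeight b m x ≤ 1 := by
  rw [gridWeight, ENNReal.ofReal_le_one, Real.exp_le_one_iff, neg_nonpos]
  positivity

theorem tendsto_gridWeight (b : ℝ) {x : ℝ≥0 → E} (hx : Continuous x) :
    Filter.Tendsto (fun m => gridWeight b m x) Filter.atTop (nhds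
      (ENNReal.ofReal (Real.exp (-(b ^ 2 * ∫ s in (0 : ℝ)..1, ‖x s.toNNReal‖ ^ 2))))) := by
  have h1 := tendsto_left_riemannSum (f := fun s => ‖x s.toNNReal‖ ^ 2)
    ((hx.comp continuous_real_toNNReal).norm.pow 2)
  have h2 := ENNReal.tendsto_ofReal
    ((Real.continuous_exp.tendsto _).comp ((h1.const_mul (b ^ 2)).neg))
  refine h2.congr fun m => ?_
  have h3 : ∀ j : ℕ, ((j : ℝ) / m).toNNReal = (j : ℝ≥0) / m := fun j => by
    rw [Real.toNNReal_div (Nat.cast_nonneg _)]; simp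
  simp only [Function.comp_apply, h3, gridWeight]

end gridWeight

/-- Independence is used for the Riemann sums, which depend on finitely many times and so are
measurable for the product σ-algebra on paths; dominated convergence then passes to the integrals.
-/
theorem exp_neg_le_lintegral_exp_neg_integral {Ω : Type*} [MeasurableSpace Ω] {P : Measure Ω}
    [IsProbabilityMeasure P] {d : ℕ} {β β' : ℝ≥0 → Ω → EuclideanSpace ℝ (Fin d)}
    (hβ : IsStdBrownian β P) (hβ' : IsStdBrownian β' P)
    (hind : IndepFun (fun (ω : Ω) (t : ℝ≥0) => β t ω) (fun (ω : Ω) (t : ℝ≥0) => β' t ω) P)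
    {b : ℝ} (hb : 0 ≤ b) :
    ENNReal.ofReal (Real.exp (-b)) ^ d * ENNReal.ofReal (Real.exp (-b)) ^ d ≤
      ∫⁻ ω, ENNReal.ofReal (Real.exp (-(b ^ 2 * (∫ s in (0 : ℝ)..1, ‖β s.toNNReal ω‖ ^ 2)))) *
        ENNReal.ofReal (Real.exp (-(b ^ 2 * ∫ s in (0 : ℝ)..1, ‖β' s.toNNReal ω‖ ^ 2))) ∂P := by
  have hm : ∀ m, AEMeasurable (fun ω => gridWeight b m fun t => β t ω) P :=
    aemeasurable_gridWeight b hβ.aemeasurable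
  have hm' : ∀ m, AEMeasurable (fun ω => gridWeight b m fun t => β' t ω) P :=
    aemeasurable_gridWeight b hβ'.aemeasurable
  have ht : Filter.Tendsto (fun m => ∫⁻ ω, (gridWeight b m fun t => β t ω) *
        (gridWeight b m fun t => β' t ω) ∂P)
      Filter.atTop (nhds (∫⁻ ω,
        ENNReal.ofReal (Real.exp (-(b ^ 2 * (∫ s in (0 : ℝ)..1, ‖β s.toNNReal ω‖ ^ 2)))) *
        ENNReal.ofReal (Real.exp (-(b ^ 2 * ∫ s in (0 : ℝ)..1, ‖β' s.toNNReal ω‖ ^ 2))) ∂P)) := by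
    refine tendsto_lintegral_of_dominated_convergence' (fun _ => 1)
      (fun m => (hm m).mul (hm' m)) (fun m => Filter.Eventually.of_forall fun ω => ?_)
      (by simp) ?_
    · exact mul_le_one' (gridWeight_le_one _ _ _) (gridWeight_le_one _ _ _)
    · filter_upwards [hβ.ae_continuous, hβ'.ae_continuous] with ω h1 h2
      exact ENNReal.Tendsto.mul (tendsto_gridWeight b h1) (Or.inr ENNReal.ofReal_ne_top)
        (tendsto_gridWeight b h2) (Or.inr ENNReal.ofReal_ne_top)
  refine ge_of_tendsto ht ?_
  obtain ⟨N, hN⟩ := exists_nat_ge (2 * b)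
  filter_upwards [Filter.eventually_ge_atTop (max N 1)] with m hm1
  have hm0 : 0 < m := (le_max_right N 1).trans hm1
  have hmb : 2 * b ≤ m := hN.trans (by exact_mod_cast (le_max_left N 1).trans hm1)
  have hRind : IndepFun (fun ω => gridWeight b m fun t => β t ω)
      (fun ω => gridWeight b m fun t => β' t ω) P :=
    hind.comp (measurable_gridWeight b m) (measurable_gridWeight b m)
  rw [lintegral_mul_eq_lintegral_mul_lintegral_of_indepFun'' (hm m) (hm' m) hRind]
  exact mul_le_mul' (hβ.exp_neg_pow_le_lintegral_grid hb hm0 hmb)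
    (hβ'.exp_neg_pow_le_lintegral_grid hb hm0 hmb)

/-- Take `M = 2 Q + 2 Q' + 1/n`, the last term keeping `M` positive. With `z = n (Q + Q')` the claim
becomes `2 z + 1 ≤ exp (z + 2)`. -/
theorem ofReal_exp_mul_le_crossIntegral {Ω : Type*} {d : ℕ}
    {β β' : ℝ≥0 → Ω → EuclideanSpace ℝ (Fin d)} {ω : Ω} (hc : Continuous fun t => β t ω)
    (hc' : Continuous fun t => β' t ω) {n : ℝ} (hn : 0 < n) :
    ENNReal.ofReal (Real.exp (-2) * n) *
      (ENNReal.ofReal (Real.exp (-(n * ∫ s in (0 : ℝ)..1, ‖β s.toNNReal ω‖ ^ 2))) *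
        ENNReal.ofReal (Real.exp (-(n * ∫ s in (0 : ℝ)..1, ‖β' s.toNNReal ω‖ ^ 2)))) ≤
      crossIntegral β β' ω := by
  set Q := ∫ s in (0 : ℝ)..1, ‖β s.toNNReal ω‖ ^ 2 with hQ
  set Q' := ∫ s in (0 : ℝ)..1, ‖β' s.toNNReal ω‖ ^ 2 with hQ'
  have hQ0 : 0 ≤ Q := intervalIntegral.integral_nonneg zero_le_one fun _ _ => by positivity
  have hQ0' : 0 ≤ Q' := intervalIntegral.integral_nonneg zero_le_one fun _ _ => by positivity
  have hM : 0 < 2 * Q + 2 * Q' + 1 / n := by positivity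
  refine le_trans ?_ (ofReal_inv_le_lintegral_inv_enorm_sub_sq
    (hc.comp continuous_real_toNNReal) (hc'.comp continuous_real_toNNReal) hM
    (by simp only [Function.comp_apply, ← hQ, ← hQ']; linarith [one_div_pos.2 hn]))
  rw [← ENNReal.ofReal_mul (Real.exp_pos _).le, ← ENNReal.ofReal_mul (by positivity)]
  refine ENNReal.ofReal_le_ofReal ?_
  rw [le_div_iff₀ hM]
  have h1 : Real.exp (-2) * n * (Real.exp (-(n * Q)) * Real.exp (-(n * Q'))) *
      (2 * Q + 2 * Q' + 1 / n) =
      Real.exp (-(n * Q + n * Q' + 2)) * (2 * (n * Q + n * Q') + 1) := by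
    have : Real.exp (-(n * Q + n * Q' + 2)) =
        Real.exp (-2) * (Real.exp (-(n * Q)) * Real.exp (-(n * Q'))) := by
      rw [← Real.exp_add, ← Real.exp_add]; congr 1; ring
    rw [this]
    field_simp
  rw [h1, Real.exp_neg, inv_mul_le_one₀ (Real.exp_pos _)]
  have h2 := Real.add_one_le_exp (n * Q + n * Q')
  have h3 : 2 ≤ Real.exp 2 := by linarith [Real.add_one_le_exp (2 : ℝ)]
  have h4 : 0 ≤ n * Q + n * Q' := by positivity
  rw [Real.exp_add]
  nlinarith

/-- The `n`-th power of `exp (-n Q)` is `exp (-n² Q)`, so the small-ball estimate applies with `b =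
n`. The exponent `10` is `2` from the pathwise bound plus `4` for the coordinates of each motion. -/
theorem le_lintegral_crossIntegral_pow {Ω : Type*} [MeasurableSpace Ω] {P : Measure Ω}
    [IsProbabilityMeasure P] {β β' : ℝ≥0 → Ω → EuclideanSpace ℝ (Fin 4)}
    (hβ : IsStdBrownian β P) (hβ' : IsStdBrownian β' P)
    (hind : IndepFun (fun (ω : Ω) (t : ℝ≥0) => β t ω) (fun (ω : Ω) (t : ℝ≥0) => β' t ω) P)
    {n : ℕ} (hn : 0 < n) :
    ENNReal.ofReal (Real.exp (-10) * n) ^ n ≤ ∫⁻ ω, crossIntegral β β' ω ^ n ∂P := by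
  have hn' : (0 : ℝ) < n := by exact_mod_cast hn
  have hexp : ∀ q : ℝ, ENNReal.ofReal (Real.exp (-(n * q))) ^ n =
      ENNReal.ofReal (Real.exp (-((n : ℝ) ^ 2 * q))) := fun q => by
    rw [← ENNReal.ofReal_pow (Real.exp_pos _).le, ← Real.exp_nat_mul]
    congr 2; ring
  calc ENNReal.ofReal (Real.exp (-10) * n) ^ n
      = ENNReal.ofReal (Real.exp (-2) * n) ^ n *
          (ENNReal.ofReal (Real.exp (-(n : ℝ))) ^ 4 *
            ENNReal.ofReal (Real.exp (-(n : ℝ))) ^ 4) := by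
        rw [← pow_add, ← ENNReal.ofReal_pow (by positivity), ← ENNReal.ofReal_pow (by positivity),
          ← ENNReal.ofReal_pow (by positivity), ← ENNReal.ofReal_mul (by positivity), mul_pow,
          mul_pow, mul_right_comm, ← Real.exp_nat_mul, ← Real.exp_nat_mul, ← Real.exp_nat_mul,
          ← Real.exp_add]
        congr 3
        push_cast; ring
    _ ≤ ENNReal.ofReal (Real.exp (-2) * n) ^ n * ∫⁻ ω,
        ENNReal.ofReal (Real.exp (-((n : ℝ) ^ 2 * ∫ s in (0 : ℝ)..1, ‖β s.toNNReal ω‖ ^ 2))) *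
        ENNReal.ofReal (Real.exp (-((n : ℝ) ^ 2 * ∫ s in (0 : ℝ)..1, ‖β' s.toNNReal ω‖ ^ 2)))
          ∂P := by
        gcongr
        exact exp_neg_le_lintegral_exp_neg_integral hβ hβ' hind hn'.le
    _ ≤ _ := by
        rw [← lintegral_const_mul' _ _ (by finiteness)]
        refine lintegral_mono_ae ?_
        filter_upwards [hβ.ae_continuous, hβ'.ae_continuous] with ω h1 h2
        rw [← hexp, ← hexp, ← mul_pow, ← mul_pow]
        gcongr
        exact ofReal_exp_mul_le_crossIntegral h1 h2 hn'

/-! ### From integer to real exponents -/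

theorem lintegral_rpow_le_rpow {Ω : Type*} [MeasurableSpace Ω] {P : Measure Ω}
    [IsProbabilityMeasure P] {X : Ω → ℝ≥0∞} (hX : AEMeasurable X P) {p q : ℝ} (hp : 0 < p)
    (hpq : p ≤ q) : ∫⁻ ω, X ω ^ p ∂P ≤ (∫⁻ ω, X ω ^ q ∂P) ^ (p / q) := by
  have h := eLpNorm'_le_eLpNorm'_of_exponent_le hp hpq P hX.aestronglyMeasurable
  simp only [eLpNorm', enorm_eq_self] at h
  have h2 := ENNReal.rpow_le_rpow h hp.le
  rwa [← ENNReal.rpow_mul, ← ENNReal.rpow_mul, one_div_mul_cancel hp.ne', ENNReal.rpow_one,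
    one_div_mul_eq_div] at h2

theorem ofReal_le_posMoment_crossIntegral {Ω : Type*} [MeasurableSpace Ω] {P : Measure Ω}
    [IsProbabilityMeasure P] {β β' : ℝ≥0 → Ω → EuclideanSpace ℝ (Fin 4)}
    (hβ : IsStdBrownian β P) (hβ' : IsStdBrownian β' P)
    (hind : IndepFun (fun (ω : Ω) (t : ℝ≥0) => β t ω) (fun (ω : Ω) (t : ℝ≥0) => β' t ω) P)
    {p : ℝ} (hp : 1 ≤ p) :
    ENNReal.ofReal ((Real.exp (-10) / 2) ^ p * p ^ p) ≤ posMoment (crossIntegral β β') P p := by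
  have hp0 : 0 < p := by linarith
  have hn : 0 < ⌊p⌋₊ := Nat.floor_pos.2 hp
  have hn' : (1 : ℝ) ≤ (⌊p⌋₊ : ℝ) := by exact_mod_cast hn
  have hnp : (⌊p⌋₊ : ℝ) ≤ p := Nat.floor_le hp0.le
  have hlt : p < ⌊p⌋₊ + 1 := Nat.lt_floor_add_one p
  set n := ⌊p⌋₊
  have hn0 : (n : ℝ) ≠ 0 := by linarith
  have h1 := lintegral_rpow_le_rpow (hβ.aemeasurable_crossIntegral hβ') (p := n) (q := p)
    (by linarith) hnp
  simp only [ENNReal.rpow_natCast] at h1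
  have h2 := ENNReal.rpow_le_rpow ((le_lintegral_crossIntegral_pow hβ hβ' hind hn).trans h1)
    (z := p / n) (by positivity)
  rw [← ENNReal.rpow_mul, ← ENNReal.rpow_natCast, ← ENNReal.rpow_mul,
    div_mul_div_cancel₀ hp0.ne', div_self hn0, ENNReal.rpow_one, mul_div_cancel₀ _ hn0] at h2
  refine le_trans ?_ h2
  rw [ENNReal.ofReal_rpow_of_nonneg (by positivity) hp0.le, ← Real.mul_rpow (by positivity) hp0.le]
  refine ENNReal.ofReal_le_ofReal (Real.rpow_le_rpow (by positivity) ?_ hp0.le)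
  -- Since `p < n + 1 ≤ 2 n`, rounding down costs only the factor `1/2` in the base.
  have := Real.exp_pos (-10)
  nlinarith

theorem exists_posMoment_crossIntegral_le :
    ∃ C : ℝ, 0 < C ∧ ∀ {Ω : Type*} [MeasurableSpace Ω] {P : Measure Ω}
      [IsProbabilityMeasure P] {β β' : ℝ≥0 → Ω → EuclideanSpace ℝ (Fin 4)},
      IsStdBrownian β P → IsStdBrownian β' P →
      IndepFun (fun (ω : Ω) (t : ℝ≥0) => β t ω) (fun (ω : Ω) (t : ℝ≥0) => β' t ω) P →
      ∀ {p : ℝ}, 1 ≤ p →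
      posMoment (crossIntegral β β') P p ≤ ENNReal.ofReal (C ^ p * p ^ (2 * p)) := by
  obtain ⟨A, hA1, hA⟩ := exists_lintegral_rpow_abs_sub_le
  -- Rounding up gives `n < p + 1 ≤ 2 p`, so `(A^n n!)² ≤ ((2 A p)²)^n`.
  refine ⟨(2 * A) ^ 2, by positivity, fun {Ω} _ {P} _ {β β'} hβ hβ' hind {p} hp => ?_⟩
  have hp0 : 0 < p := by linarith
  have hpn : p ≤ ⌈p⌉₊ := Nat.le_ceil p
  have hlt : (⌈p⌉₊ : ℝ) < p + 1 := Nat.ceil_lt_add_one hp0.le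
  set n := ⌈p⌉₊
  have hn0 : (0 : ℝ) < n := by linarith
  have h1 := lintegral_rpow_le_rpow (hβ.aemeasurable_crossIntegral hβ') hp0 hpn
  simp only [ENNReal.rpow_natCast] at h1
  have h2 : ∫⁻ ω, crossIntegral β β' ω ^ n ∂P ≤ ENNReal.ofReal ((2 * A * p) ^ 2) ^ n := by
    refine (lintegral_crossIntegral_pow_le hβ hβ' hind hA n).trans ?_
    have h3 : (n.factorial : ℝ≥0∞) ≤ ENNReal.ofReal (n : ℝ) ^ n := by
      rw [ENNReal.ofReal_natCast]
      exact_mod_cast Nat.factorial_le_pow n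
    calc (ENNReal.ofReal A ^ n * n.factorial) ^ 2
        ≤ (ENNReal.ofReal A ^ n * ENNReal.ofReal (n : ℝ) ^ n) ^ 2 := by gcongr
      _ = ENNReal.ofReal ((A * n) ^ 2) ^ n := by
          rw [← mul_pow, ← ENNReal.ofReal_mul (by linarith), ← pow_mul, mul_comm n 2, pow_mul,
            ENNReal.ofReal_pow (by positivity)]
      _ ≤ _ := by
          gcongr ENNReal.ofReal (?_ ^ 2) ^ n
          nlinarith
  refine h1.trans ((ENNReal.rpow_le_rpow h2 (by positivity)).trans (le_of_eq ?_))
  rw [← ENNReal.rpow_natCast, ← ENNReal.rpow_mul, mul_div_cancel₀ _ hn0.ne',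
    ENNReal.ofReal_rpow_of_nonneg (by positivity) hp0.le]
  congr 1
  rw [mul_pow, Real.mul_rpow (by positivity) (by positivity), Real.rpow_mul hp0.le]
  norm_cast

/-! ### Carleman's condition and exponential moments -/

theorem tsum_ofReal_div_pnat {κ : ℝ} (hκ : 0 < κ) :
    ∑' p : ℕ+, ENNReal.ofReal (κ / (p : ℕ)) = ∞ := by
  by_contra h
  have h1 : Summable fun p : ℕ+ => κ / ((p : ℕ) : ℝ) := by
    have := ENNReal.summable_toReal h
    refine this.congr fun p => ?_
    rw [ENNReal.toReal_ofReal (by positivity)]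
  have h2 : Summable fun n : ℕ => κ / ((n + 1 : ℕ) : ℝ) :=
    (Equiv.pnatEquivNat.symm.summable_iff (f := fun p : ℕ+ => κ / ((p : ℕ) : ℝ))).2 h1
  have h3 : Summable fun n : ℕ => κ / (n : ℝ) := (summable_nat_add_iff 1).1 h2
  refine Real.not_summable_one_div_natCast ((h3.mul_left κ⁻¹).congr fun n => ?_)
  field_simp

/-- The growth `p^(2p)` is borderline: the power `-1/(2p)` turns the bound into exactly `C^(-1/2) /
p`, a harmonic term. -/
theorem carlemanCondition_of_posMoment_le {Ω : Type*} [MeasurableSpace Ω] {P : Measure Ω}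
    {X : Ω → ℝ≥0∞} {C : ℝ} (hC : 0 < C)
    (h : ∀ p : ℝ, 1 ≤ p → posMoment X P p ≤ ENNReal.ofReal (C ^ p * p ^ (2 * p))) :
    CarlemanCondition X P := by
  rw [CarlemanCondition, eq_top_iff, ← tsum_ofReal_div_pnat (κ := C ^ (-(1 / 2) : ℝ))
    (by positivity)]
  refine ENNReal.tsum_le_tsum fun p => ?_
  have hp : (1 : ℝ) ≤ ((p : ℕ) : ℝ) := by exact_mod_cast p.2
  set q : ℝ := ((p : ℕ) : ℝ)
  have hq : 0 < q := by linarith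
  calc ENNReal.ofReal (C ^ (-(1 / 2) : ℝ) / q)
      = ENNReal.ofReal (C ^ q * q ^ (2 * q)) ^ (-1 / (2 * q)) := by
        rw [ENNReal.ofReal_rpow_of_pos (by positivity), Real.mul_rpow (by positivity)
          (by positivity), ← Real.rpow_mul hC.le, ← Real.rpow_mul hq.le]
        congr 1
        rw [show q * (-1 / (2 * q)) = -(1 / 2) by field_simp,
          show 2 * q * (-1 / (2 * q)) = -1 by field_simp, Real.rpow_neg_one, div_eq_mul_inv]
    _ ≤ _ := by
        rw [neg_div, ENNReal.rpow_neg, ENNReal.rpow_neg, ENNReal.inv_le_inv]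
        exact ENNReal.rpow_le_rpow (h q hp) (by positivity)

theorem ofReal_pow_mul_pow_div_factorial_le_exp {θ : ℝ} (hθ : 0 < θ) (x : ℝ≥0∞) (n : ℕ) :
    (ENNReal.ofReal θ * x) ^ n / n.factorial ≤ EReal.exp ((θ : EReal) * (x : EReal)) := by
  induction x using ENNReal.recTopCoe with
  | top =>
    rw [EReal.coe_ennreal_top, EReal.coe_mul_top_of_pos hθ, EReal.exp_top]
    exact le_top
  | coe x =>
    have h1 : ((x : ℝ≥0∞) : EReal) = ((x : ℝ) : EReal) := rfl
    rw [h1, ← EReal.coe_mul, EReal.exp_coe, ← ENNReal.ofReal_coe_nnreal,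
      ← ENNReal.ofReal_mul hθ.le, ← ENNReal.ofReal_pow (by positivity),
      ← ENNReal.ofReal_natCast n.factorial, ← ENNReal.ofReal_div_of_pos (by positivity)]
    exact ENNReal.ofReal_le_ofReal (Real.pow_div_factorial_le_exp _ (by positivity) n)

/-- The exponential dominates each single term of its series. With `θ = 2 / c` and `n! ≤ n^n`, the
`n`-th term has expectation at least `2^n`, which is unbounded. -/
theorem expMoment_eq_top_of_le_lintegral_pow {Ω : Type*} [MeasurableSpace Ω] {P : Measure Ω}
    {X : Ω → ℝ≥0∞} {c : ℝ} (hc : 0 < c)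
    (h : ∀ n : ℕ, 0 < n → ENNReal.ofReal (c * n) ^ n ≤ ∫⁻ ω, X ω ^ n ∂P) :
    expMoment X P (2 / c) = ∞ := by
  have h1 : ∀ n : ℕ, 0 < n → (2 : ℝ≥0∞) ^ n ≤ expMoment X P (2 / c) := by
    intro n hn
    have hf : (n.factorial : ℝ≥0∞) ≠ 0 := by exact_mod_cast n.factorial_ne_zero
    have h3 : (n.factorial : ℝ≥0∞) ≤ ENNReal.ofReal (n : ℝ) ^ n := by
      rw [ENNReal.ofReal_natCast]
      exact_mod_cast Nat.factorial_le_pow n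
    calc (2 : ℝ≥0∞) ^ n ≤ ENNReal.ofReal (2 / c) ^ n / n.factorial * ENNReal.ofReal (c * n) ^ n := by
          have h4 : ENNReal.ofReal (2 / c) ^ n * ENNReal.ofReal (c * n) ^ n =
              ENNReal.ofReal (n : ℝ) ^ n * 2 ^ n := by
            rw [← mul_pow, ← mul_pow, ← ENNReal.ofReal_mul (by positivity),
              ← ENNReal.ofReal_ofNat 2, ← ENNReal.ofReal_mul (by positivity)]
            congr 2
            field_simp
          rw [ENNReal.div_eq_inv_mul, mul_assoc, h4, ← mul_assoc, ← ENNReal.div_eq_inv_mul]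
          refine le_mul_of_one_le_left' ?_
          rwa [ENNReal.le_div_iff_mul_le (Or.inl hf) (Or.inl (ENNReal.natCast_ne_top _)), one_mul]
      _ ≤ ENNReal.ofReal (2 / c) ^ n / n.factorial * ∫⁻ ω, X ω ^ n ∂P := by
          gcongr; exact h n hn
      _ = ∫⁻ ω, (ENNReal.ofReal (2 / c) * X ω) ^ n / n.factorial ∂P := by
          rw [← lintegral_const_mul' _ _
            (ENNReal.div_ne_top (ENNReal.pow_ne_top ENNReal.ofReal_ne_top) hf)]
          refine lintegral_congr fun ω => ?_
          rw [mul_pow, ENNReal.div_eq_inv_mul, ENNReal.div_eq_inv_mul, mul_assoc]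
      _ ≤ _ := lintegral_mono fun ω =>
          ofReal_pow_mul_pow_div_factorial_le_exp (by positivity) _ n
  have h2 : Filter.Tendsto (fun n : ℕ => (2 : ℝ≥0∞) ^ (n + 1)) Filter.atTop (nhds ∞) :=
    (ENNReal.tendsto_pow_atTop_nhds_top_iff.2 (by norm_num)).comp (Filter.tendsto_add_atTop_nat 1)
  exact eq_top_iff.2 (le_of_tendsto' h2 fun n => h1 (n + 1) n.succ_pos)

end BrownianCross

theorem mainTheorem6 :
    ∃ c C θ : ℝ, 0 < c ∧ 0 < C ∧ 0 < θ ∧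
      ∀ (Ω : Type*) [MeasurableSpace Ω] (P : Measure Ω) [IsProbabilityMeasure P]
        (β β' : ℝ≥0 → Ω → EuclideanSpace ℝ (Fin 4)),
        BrownianCross.IsStdBrownian β P → BrownianCross.IsStdBrownian β' P →
        IndepFun (fun (ω : Ω) (t : ℝ≥0) => β t ω) (fun (ω : Ω) (t : ℝ≥0) => β' t ω) P →
        (∀ p : ℝ, 1 ≤ p →
          ENNReal.ofReal (c ^ p * p ^ p)
              ≤ BrownianCross.posMoment (BrownianCross.crossIntegral β β') P p ∧
            BrownianCross.posMoment (BrownianCross.crossIntegral β β') P p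
              ≤ ENNReal.ofReal (C ^ p * p ^ (2 * p))) ∧
        BrownianCross.CarlemanCondition (BrownianCross.crossIntegral β β') P ∧
        BrownianCross.expMoment (BrownianCross.crossIntegral β β') P θ = ∞ := by
  obtain ⟨C, hC, hup⟩ := BrownianCross.exists_posMoment_crossIntegral_le
  refine ⟨Real.exp (-10) / 2, C, 2 / Real.exp (-10), by positivity, hC, by positivity,
    fun Ω _ P _ β β' hβ hβ' hind => ⟨fun p hp => ⟨?_, hup hβ hβ' hind hp⟩, ?_, ?_⟩⟩
  · exact BrownianCross.ofReal_le_posMoment_crossIntegral hβ hβ' hind hp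
  · exact BrownianCross.carlemanCondition_of_posMoment_le hC fun p hp => hup hβ hβ' hind hp
  · exact BrownianCross.expMoment_eq_top_of_le_lintegral_pow (Real.exp_pos _) fun n hn =>
      BrownianCross.le_lintegral_crossIntegral_pow hβ hβ' hind hn
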